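/- Let $S$ be a finitely generated (abstract, discrete) free group, let $p$ be a prime number and let $n\ge 1$ be an integer. For a group $G$, let $[H,K]$ denote the subgroup generated by the commutators of elements of $H$ with elements of $K$, and $H^p$ the subgroup generated by the $p$-th powers of elements of $H$, for subgroups $H,K\le G$. Define inductively the descending central series $G_1=G$, $G_{i+1}=[G_i,G]$; the descending $p$-central series $G^{(1)}=G$, $G^{(i+1)}=(G^{(i)})^p[G^{(i)},G]$; and the $p$-Zassenhaus filtration $G_{(1)}=G$, $G_{(m)}=(G_{(\lceil m/p\rceil)})^p\prod_{i+j=m}[G_{(i)},G_{(j)}]$ for $m\ge 2$, where $i,j\ge 1$. For a commutative unital ring $\Lambda$, let $\mathbb U_m(\Lambda)$ be the group of upper-triangular unipotent $m\times m$ matrices with entries in $\Lambda$. Then: (a) $S_{(n)}=\bigcap_{\rho}\ker\rho$, where $\rho$ runs over all group homomorphisms $S\to\mathbb U_n(\mathbb F_p)$; (b) $S_n=\bigcap_{\rho}\ker\rho$, where $\rho$ runs over all group homomorphisms $S\to\mathbb U_n(\mathbb Z)$; (c) $S^{(n)}=\bigcap_{k=1}^{n-1}\bigcap_{\rho}\ker\rho$,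 where for each $k$, $\rho$ runs over all group homomorphisms $S\to\mathbb U_{k+1}(\mathbb Z/p^{n-k}\mathbb Z)$ (for $n=1$ the empty intersection is understood as $S$). -/

import Mathlib

/-- `U_n(Λ)`: the group of upper-triangular unipotent `n × n` matrices over `Λ`, as a subgroup
of `GL_n(Λ)`. -/
def unipotentGroup (n : ℕ) (Λ : Type*) [CommRing Λ] : Subgroup (Matrix.GeneralLinearGroup (Fin n) Λ) where
  carrier := {A | (∀ i j, j < i → (A : Matrix (Fin n) (Fin n) Λ) i j = 0) ∧
    ∀ i, (A : Matrix (Fin n) (Fin n) Λ) i i = 1}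
  one_mem' := ⟨fun i j h => by simp [Matrix.one_apply_ne h.ne'], fun i => by simp⟩
  mul_mem' := by
    rintro A B ⟨hA, hA'⟩ ⟨hB, hB'⟩
    refine ⟨fun i j h => ?_, fun i => ?_⟩
    · rw [Units.val_mul, Matrix.mul_apply]
      refine Finset.sum_eq_zero fun k _ => ?_
      rcases lt_or_ge k i with hk | hk
      · rw [hA i k hk, zero_mul]
      · rw [hB k j (lt_of_lt_of_le h hk), mul_zero]
    · rw [Units.val_mul, Matrix.mul_apply, Finset.sum_eq_single i]
      · rw [hA', hB', one_mul]
      · intro k _ hk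
        rcases lt_or_gt_of_ne hk with hk | hk
        · rw [hA i k hk, zero_mul]
        · rw [hB k i hk, mul_zero]
      · simp
  inv_mem' := by
    rintro A ⟨hA, hA'⟩
    have hT : (A : Matrix (Fin n) (Fin n) Λ).BlockTriangular id := fun i j h => hA i j h
    have hI : (A⁻¹ : Matrix.GeneralLinearGroup (Fin n) Λ).val.BlockTriangular id := by
      rw [Matrix.coe_units_inv]
      have := A.isUnit.invertible
      exact Matrix.blockTriangular_inv_of_blockTriangular hT
    refine ⟨fun i j h => hI h, fun i => ?_⟩
    have h1 : (A : Matrix (Fin n) (Fin n) Λ) * (A⁻¹ : Matrix.GeneralLinearGroup (Fin n) Λ).val = 1 := by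
      rw [← Units.val_mul, mul_inv_cancel, Units.val_one]
    have h2 := congrFun (congrFun h1 i) i
    rw [Matrix.mul_apply, Finset.sum_eq_single i] at h2
    · simpa [hA'] using h2
    · intro k _ hk
      rcases lt_or_gt_of_ne hk with hk | hk
      · rw [hA i k hk, zero_mul]
      · rw [hI (i := k) (j := i) hk, mul_zero]
    · simp

/-- `H^m`: the subgroup generated by the `m`-th powers of the elements of `H`. -/
def powSubgroup {G : Type*} [Group G] (H : Subgroup G) (m : ℕ) : Subgroup G :=
  Subgroup.closure {y | ∃ x ∈ H, x ^ m = y}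

/-- The descending central series `G_n`, indexed from `n = 1` with `G_1 = G` (Mathlib's series is
indexed from `0`; the value at `n = 0` is a dummy). -/
def descendingCentralSeries (G : Type*) [Group G] (n : ℕ) : Subgroup G :=
  (⊤ : Subgroup G).lowerCentralSeries (n - 1)

/-- The descending `p`-central series `G^(n)`, indexed from `n = 1`
(the value at `0` is a dummy). -/
def descendingPCentralSeries (p : ℕ) (G : Type*) [Group G] : ℕ → Subgroup G
  | 0 => ⊤
  | 1 => ⊤
  | n + 2 => powSubgroup (descendingPCentralSeries p G (n + 1)) p ⊔
      ⁅descendingPCentralSeries p G (n + 1), (⊤ : Subgroup G)⁆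

/-- The `p`-Zassenhaus filtration `G_(n)`, indexed from `n = 1` (the value at `0` is a dummy);
`n ⌈/⌉ p` is the least integer `≥ n / p`. All the factors of the product are normal subgroups,
so their product is their supremum. -/
def zassenhausFiltration (p : ℕ) [hp : Fact p.Prime] (G : Type*) [Group G] (n : ℕ) :
    Subgroup G :=
  if _hn : n ≤ 1 then ⊤
  else powSubgroup (zassenhausFiltration p G (n ⌈/⌉ p)) p ⊔
    ⨆ (i : ℕ) (j : ℕ) (_ : 1 ≤ i ∧ 1 ≤ j ∧ i + j = n),
      ⁅zassenhausFiltration p G i, zassenhausFiltration p G j⁆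
termination_by n
decreasing_by
  · have h2 := hp.out.two_le
    rw [Nat.ceilDiv_eq_add_pred_div]
    rw [Nat.div_lt_iff_lt_mul (by omega)]
    obtain ⟨m, rfl⟩ : ∃ m, n = m + 2 := ⟨n - 2, by omega⟩
    have h3 : (m + 1) * 2 ≤ (m + 1) * p := Nat.mul_le_mul_left _ h2
    have h4 : (m + 2) * p = (m + 1) * p + p := by ring
    omega
  · omega
  · omega

theorem zassenhausFiltration_one (p : ℕ) [Fact p.Prime] (G : Type*) [Group G] :
    zassenhausFiltration p G 1 = ⊤ := by
  rw [zassenhausFiltration, dif_pos le_rfl]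

theorem zassenhausFiltration_eq (p : ℕ) [Fact p.Prime] (G : Type*) [Group G] (n : ℕ)
    (hn : 2 ≤ n) :
    zassenhausFiltration p G n = powSubgroup (zassenhausFiltration p G (n ⌈/⌉ p)) p ⊔
      ⨆ (i : ℕ) (j : ℕ) (_ : 1 ≤ i ∧ 1 ≤ j ∧ i + j = n),
        ⁅zassenhausFiltration p G i, zassenhausFiltration p G j⁆ := by
  rw [zassenhausFiltration, dif_neg (by omega)]

/-! Each inclusion into an intersection of kernels comes from a filtration of the unipotent group.
Call `g` of weight `m` if `g - 1` vanishes at distance less than `m` from the diagonal or, for the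
`p`-central series, if its entries at distance `d` are divisible by `p ^ (m - d)`. Commutators add
weights. In the first filtration `p`-th powers multiply the weight by `p` in characteristic `p`; in
the second they raise it by one. Elements of weight `n` are trivial in the matrix groups considered.

The converse uses a Hall-type basis. Modulo `S_n`, every `g` is an ordered product of powers `τ_t ^
a t`, where `t` runs over the standard bracketings of Lyndon words of length less than `n`
(`exists_lyndon_prod`). A word `w` defines a representation by superdiagonal zeros and ones whose
entries are Magnus coefficients at factors of `w`. The Magnus expansion of `τ_t - 1` starts with the
word of `t`, with coefficient `1`, followed by lexicographically larger words of the same length and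
by longer words (`IsLyndonTree.hasLeadingWord`). If `g` is killed by all these representations, the
one attached to a minimal leading word isolates a single exponent in a corner entry.

Over `ℤ` this forces all exponents to vanish. Over `𝔽_p`, write `a t = p ^ v * c` with `p ∤ c`. The
leading word of `τ_t ^ p ^ v` is the `p ^ v`-th power of a Lyndon word; such powers are distinct for
distinct `t`, so every nontrivial factor has `p ^ v * |t| ≥ n` and lies in `S_(n)`. For the
`p`-central series, minimising `|t| + v` instead yields `|t| + v ≥ n`, so each factor lies in
`S^(n)`. -/

/-! ### Lyndon words and their standard bracketings -/

section Words

variable {X : Type*}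

/-- The `k`-th power of a word. -/
def List.wordPow (u : List X) : ℕ → List X
  | 0 => []
  | k + 1 => u ++ u.wordPow k

theorem List.wordPow_append (u : List X) (k : ℕ) : u.wordPow k ++ u = u ++ u.wordPow k := by
  induction k with
  | zero => simp [List.wordPow]
  | succ k ih => rw [List.wordPow, List.append_assoc, ih]

theorem List.length_wordPow (u : List X) (k : ℕ) : (u.wordPow k).length = k * u.length := by
  induction k with
  | zero => simp [List.wordPow]
  | succ k ih => rw [List.wordPow, List.length_append, ih]; ring

/-- The word read off the leaves of a tree. -/
def FreeMagma.word : FreeMagma X → List X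
  | .of x => [x]
  | .mul a b => a.word ++ b.word

theorem FreeMagma.word_ne_nil (t : FreeMagma X) : t.word ≠ [] := by
  induction t using FreeMagma.rec with
  | of x => simp [FreeMagma.word]
  | mul a b iha ihb => simp [FreeMagma.word, iha]

variable [LinearOrder X]

/-- If `a < b` lexicographically, then `a` is a proper prefix of `b`, or `a` and `b` differ at some
position, so that the inequality survives appending arbitrary words. -/
theorem List.lt_iff_prefix_or_append_lt {a b : List X} (h : a < b) :
    (∃ c, c ≠ [] ∧ b = a ++ c) ∨ ∀ s t, a ++ s < b ++ t := by
  induction a generalizing b with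
  | nil => exact Or.inl ⟨b, by rintro rfl; exact lt_irrefl _ h, rfl⟩
  | cons x a ih =>
    cases b with
    | nil => exact absurd h (List.not_lt_nil _)
    | cons y b =>
      rcases List.cons_lt_cons_iff.1 h with hxy | ⟨rfl, hab⟩
      · exact Or.inr fun s t => List.cons_lt_cons_iff.2 (Or.inl hxy)
      · rcases ih hab with ⟨c, hc, rfl⟩ | h'
        · exact Or.inl ⟨c, hc, rfl⟩
        · exact Or.inr fun s t => List.cons_lt_cons_iff.2 (Or.inr ⟨rfl, h' s t⟩)

theorem List.append_lt_append_of_lt {a b : List X} (h : a < b) (hl : b.length ≤ a.length)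
    (s t : List X) : a ++ s < b ++ t := by
  rcases List.lt_iff_prefix_or_append_lt h with ⟨c, hc, rfl⟩ | h'
  · have := List.length_pos_iff.2 hc
    simp only [List.length_append] at hl
    omega
  · exact h' s t

theorem List.append_le_append_of_le {a b s t : List X} (h : a ≤ b) (hl : b.length ≤ a.length)
    (hst : s ≤ t) : a ++ s ≤ b ++ t := by
  rcases h.lt_or_eq with h | rfl
  · exact (List.append_lt_append_of_lt h hl s t).le
  · rcases hst.lt_or_eq with h | rfl
    · exact (List.append_left_lt h).le
    · exact le_rfl

theorem List.self_le_append (a b : List X) : a ≤ a ++ b := by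
  simpa using List.append_le_append_of_le (le_refl a) le_rfl (not_lt.1 (List.not_lt_nil b))

/-- A Lyndon word: a nonempty word that is smaller than each of its proper nonempty suffixes. -/
def IsLyndonWord (w : List X) : Prop :=
  w ≠ [] ∧ ∀ r s, w = r ++ s → r ≠ [] → s ≠ [] → w < s

/-- If `b = a ++ c`, cancelling `a` reduces the claim to `b < c`, which is the Lyndon property;
otherwise `a` and `b` already differ at some letter. -/
theorem IsLyndonWord.append_lt {a b : List X} (ha : a ≠ []) (hb : IsLyndonWord b) (h : a < b) :
    a ++ b < b := by
  rcases List.lt_iff_prefix_or_append_lt h with ⟨c, hc, rfl⟩ | h'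
  · exact List.append_left_lt (hb.2 a c rfl ha hc)
  · simpa using h' b []

/-- If `v = uc`, cancelling `u` from equal powers gives `u^i = c v^j`. This exceeds `v^(j+1) =
u^(i+1)` because `v < c`, yet `u^i` is a prefix of `u^(i+1)`. This keeps leading words distinct
after taking `p`-power exponents. -/
theorem IsLyndonWord.not_wordPow_eq_of_lt {u v : List X} (hu : u ≠ []) (hv : IsLyndonWord v)
    (h : u < v) (i j : ℕ) : u.wordPow (i + 1) ≠ v.wordPow (j + 1) := by
  intro he
  rcases List.lt_iff_prefix_or_append_lt h with ⟨c, hc, hvc⟩ | h'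
  · have h1 : u.wordPow i = c ++ v.wordPow j := by
      rw [List.wordPow, List.wordPow] at he
      nth_rewrite 1 [hvc] at he
      rw [List.append_assoc] at he
      exact List.append_cancel_left he
    have h2 : v.wordPow (j + 1) < c ++ v.wordPow j := by
      refine List.append_lt_append_of_lt (hv.2 u c hvc hu hc) ?_ _ _
      rw [hvc]; simp
    rw [← h1, ← he] at h2
    refine absurd h2 (not_lt.2 ?_)
    rw [List.wordPow, ← List.wordPow_append]
    exact List.self_le_append _ _
  · exact (h' (u.wordPow i) (v.wordPow j)).ne he

theorem IsLyndonWord.eq_of_wordPow_eq {u v : List X} (hu : IsLyndonWord u) (hv : IsLyndonWord v)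
    {i j : ℕ} (hi : i ≠ 0) (hj : j ≠ 0) (h : u.wordPow i = v.wordPow j) : u = v := by
  obtain ⟨i, rfl⟩ := Nat.exists_eq_succ_of_ne_zero hi
  obtain ⟨j, rfl⟩ := Nat.exists_eq_succ_of_ne_zero hj
  rcases lt_trichotomy u v with h' | h' | h'
  · exact absurd h (hv.not_wordPow_eq_of_lt hu.1 h' i j)
  · exact h'
  · exact absurd h.symm (hu.not_wordPow_eq_of_lt hv.1 h' j i)

/-- The bracketings of Lyndon words given by iterating the standard factorization. -/
inductive IsLyndonTree : FreeMagma X → Prop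
  | of (x : X) : IsLyndonTree (.of x)
  | of_mul (x : X) (b : FreeMagma X) (hb : IsLyndonTree b) (h : [x] < b.word) :
      IsLyndonTree (.mul (.of x) b)
  | mul_mul (a c b : FreeMagma X) (ha : IsLyndonTree (.mul a c)) (hb : IsLyndonTree b)
      (h : (FreeMagma.mul a c).word < b.word) (hc : b.word ≤ c.word) :
      IsLyndonTree (.mul (.mul a c) b)

namespace IsLyndonTree

theorem mul_inv {a b : FreeMagma X} (h : IsLyndonTree (.mul a b)) :
    IsLyndonTree a ∧ IsLyndonTree b ∧ a.word < b.word := by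
  cases h with
  | of_mul x b hb h => exact ⟨.of x, hb, h⟩
  | mul_mul a c b ha hb h hc => exact ⟨ha, hb, h⟩

/-- A suffix lies inside `b`, where the Lyndon property applies, or has the form `c ++ b` with `c` a
suffix of `a`. For proper `c` the tree condition bounds `b` by the right branch of `a`, which is at
most `c`; a leaf `a` has no such `c`. -/
theorem right_le_suffix {a b : FreeMagma X} (h : IsLyndonTree (.mul a b))
    (hb : IsLyndonWord b.word)
    (ha : ∀ a₁ a₂, a = .mul a₁ a₂ → ∀ r s, a.word = r ++ s → r ≠ [] → s ≠ [] → a₂.word ≤ s)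
    {r s : List X} (he : (FreeMagma.mul a b).word = r ++ s) (hr : r ≠ []) (hs : s ≠ []) :
    b.word ≤ s := by
  rw [FreeMagma.word, List.append_eq_append_iff] at he
  rcases he with ⟨c, -, hc⟩ | ⟨c, hc, hc'⟩
  · rcases eq_or_ne c [] with rfl | hne
    · rw [hc]; rfl
    · exact (hb.2 c s hc hne hs).le
  · rcases eq_or_ne c [] with rfl | hne
    · rw [hc']; rfl
    · rw [hc']
      refine le_trans ?_ (List.self_le_append c b.word)
      cases h with
      | of_mul x b hb h =>
        have := congrArg List.length hc
        have := List.length_pos_iff.2 hr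
        have := List.length_pos_iff.2 hne
        simp [FreeMagma.word] at *
        omega
      | mul_mul a₁ a₂ b h₁ h₂ h₃ h₄ => exact h₄.trans (ha a₁ a₂ rfl r c hc hr hne)

theorem suffix_aux {t : FreeMagma X} (h : IsLyndonTree t) :
    IsLyndonWord t.word ∧
    ∀ a b, t = .mul a b → ∀ r s, t.word = r ++ s → r ≠ [] → s ≠ [] → b.word ≤ s := by
  induction t using FreeMagma.rec with
  | of x =>
    refine ⟨⟨by simp [FreeMagma.word], fun r s he hr hs => ?_⟩, by simp⟩
    have := congrArg List.length he
    have := List.length_pos_iff.2 hr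
    have := List.length_pos_iff.2 hs
    simp [FreeMagma.word] at *
    omega
  | mul a b iha ihb =>
    obtain ⟨ha, hb, hab⟩ := h.mul_inv
    have key : ∀ r s, (FreeMagma.mul a b).word = r ++ s → r ≠ [] → s ≠ [] → b.word ≤ s :=
      fun r s he hr hs => h.right_le_suffix (ihb hb).1 (iha ha).2 he hr hs
    refine ⟨⟨FreeMagma.word_ne_nil _, fun r s he hr hs => ?_⟩, ?_⟩
    · exact ((ihb hb).1.append_lt a.word_ne_nil hab).trans_le (key r s he hr hs)
    · rintro a' b' heq
      cases heq
      exact key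

theorem isLyndonWord {t : FreeMagma X} (h : IsLyndonTree t) : IsLyndonWord t.word :=
  h.suffix_aux.1

theorem right_le {a b : FreeMagma X} (h : IsLyndonTree (.mul a b)) {r s : List X}
    (he : (FreeMagma.mul a b).word = r ++ s) (hr : r ≠ []) (hs : s ≠ []) : b.word ≤ s :=
  h.suffix_aux.2 a b rfl r s he hr hs

theorem word_mul_lt_right {a b : FreeMagma X} (h : IsLyndonTree (.mul a b)) :
    (FreeMagma.mul a b).word < b.word :=
  h.mul_inv.2.1.isLyndonWord.append_lt a.word_ne_nil h.mul_inv.2.2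

/-- The right branch carries the least proper suffix, so the word determines where the tree splits.
-/
theorem eq_of_word_eq {t u : FreeMagma X} (ht : IsLyndonTree t) (hu : IsLyndonTree u)
    (h : t.word = u.word) : t = u := by
  induction t using FreeMagma.rec generalizing u with
  | of x =>
    cases u with
    | of y => exact congrArg FreeMagma.of (by simpa [FreeMagma.word] using h)
    | mul c d =>
      have := List.length_pos_iff.2 c.word_ne_nil
      have := List.length_pos_iff.2 d.word_ne_nil
      have := congrArg List.length h
      simp [FreeMagma.word] at *
      omega
  | mul a b iha ihb =>
    cases u with
    | of y =>
      have := List.length_pos_iff.2 a.word_ne_nil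
      have := List.length_pos_iff.2 b.word_ne_nil
      have := congrArg List.length h
      simp [FreeMagma.word] at *
      omega
    | mul c d =>
      have h1 : b.word = d.word := le_antisymm
        (ht.right_le (h.trans rfl) c.word_ne_nil d.word_ne_nil)
        (hu.right_le (h.symm.trans rfl) a.word_ne_nil b.word_ne_nil)
      have h2 : a.word = c.word := by
        rw [FreeMagma.word, FreeMagma.word, h1] at h
        exact List.append_cancel_right h
      rw [iha ht.mul_inv.1 hu.mul_inv.1 h2, ihb ht.mul_inv.2.1 hu.mul_inv.2.1 h1]

theorem finite_length_eq [Finite X] (k : ℕ) :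
    {t : FreeMagma X | IsLyndonTree t ∧ t.word.length = k}.Finite := by
  refine Set.Finite.of_injOn (f := FreeMagma.word) (t := {l : List X | l.length = k})
    (fun t ht => ht.2) (fun t ht u hu h => ht.1.eq_of_word_eq hu.1 h) (List.finite_length_eq X k)

end IsLyndonTree

end Words

/-! ### Commutator calculus modulo the lower central series -/

section LowerCentral

open scoped commutatorElement

variable {G : Type*} [Group G]

/-- The elements commuting with `z` modulo the normal subgroup `H`. -/
def centralizerMod (H : Subgroup G) [H.Normal] (z : G) : Subgroup G :=
  (Subgroup.centralizer {QuotientGroup.mk' H z}).comap (QuotientGroup.mk' H)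

theorem mem_centralizerMod {H : Subgroup G} [H.Normal] {z w : G} :
    w ∈ centralizerMod H z ↔ ⁅w, z⁆ ∈ H := by
  rw [centralizerMod, Subgroup.mem_comap, Subgroup.mem_centralizer_singleton_iff, eq_comm,
    ← commutatorElement_eq_one_iff_mul_comm, ← map_commutatorElement, QuotientGroup.mk'_apply,
    QuotientGroup.eq_one_iff]
  exact ⟨fun h => by rw [← commutatorElement_inv]; exact H.inv_mem h,
    fun h => by rw [← commutatorElement_inv]; exact H.inv_mem h⟩

theorem commutatorElement_mem_comm {H : Subgroup G} {z w : G} (h : ⁅w, z⁆ ∈ H) : ⁅z, w⁆ ∈ H := by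
  rw [← commutatorElement_inv]; exact H.inv_mem h

theorem normal_of_commutatorElement_mem {H : Subgroup G} (h : ∀ x ∈ H, ∀ g, ⁅x, g⁆ ∈ H) :
    H.Normal where
  conj_mem x hx g := by
    have h1 := H.mul_mem (commutatorElement_mem_comm (h x hx g)) hx
    rwa [← conj_eq_commutatorElement_mul] at h1

theorem commutator_commutator_le_of_rotate {H₁ H₂ H₃ N : Subgroup G} [N.Normal]
    (h1 : ⁅⁅H₂, H₃⁆, H₁⁆ ≤ N) (h2 : ⁅⁅H₃, H₁⁆, H₂⁆ ≤ N) : ⁅⁅H₁, H₂⁆, H₃⁆ ≤ N := by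
  have key : ∀ A : Subgroup G, A ≤ N ↔ A.map (QuotientGroup.mk' N) = ⊥ := fun A => by
    rw [Subgroup.map_eq_bot_iff, QuotientGroup.ker_mk']
  rw [key, Subgroup.map_commutator, Subgroup.map_commutator] at *
  exact Subgroup.commutator_commutator_eq_bot_of_rotate h1 h2

instance descendingCentralSeries_normal (n : ℕ) : (descendingCentralSeries G n).Normal := by
  unfold descendingCentralSeries; infer_instance

theorem descendingCentralSeries_one : descendingCentralSeries G 1 = ⊤ := rfl

theorem descendingCentralSeries_succ {n : ℕ} (hn : 1 ≤ n) :
    descendingCentralSeries G (n + 1) = ⁅descendingCentralSeries G n, (⊤ : Subgroup G)⁆ := by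
  obtain ⟨n, rfl⟩ := Nat.exists_eq_add_of_le' hn
  rfl

theorem descendingCentralSeries_antitone : Antitone (descendingCentralSeries G) :=
  fun _ _ h => Subgroup.lowerCentralSeries_antitone _ (Nat.sub_le_sub_right h 1)

theorem commutator_descendingCentralSeries_le {i j : ℕ} (hi : 1 ≤ i) (hj : 1 ≤ j) :
    ⁅descendingCentralSeries G i, descendingCentralSeries G j⁆ ≤
      descendingCentralSeries G (i + j) := by
  induction j, hj using Nat.le_induction generalizing i with
  | base => rw [descendingCentralSeries_succ hi]; rfl
  | succ j hj ih =>
    rw [Subgroup.commutator_comm, descendingCentralSeries_succ hj]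
    refine commutator_commutator_le_of_rotate ?_ ?_
    · rw [Subgroup.commutator_comm ⊤, ← descendingCentralSeries_succ hi]
      refine (ih (by omega)).trans (descendingCentralSeries_antitone (by omega))
    · rw [← add_assoc, descendingCentralSeries_succ (n := i + j) (by omega)]
      exact Subgroup.commutator_mono (ih hi) le_rfl

theorem commutatorElement_mem_descendingCentralSeries {i j : ℕ} (hi : 1 ≤ i) (hj : 1 ≤ j) {x y : G}
    (hx : x ∈ descendingCentralSeries G i) (hy : y ∈ descendingCentralSeries G j) :
    ⁅x, y⁆ ∈ descendingCentralSeries G (i + j) :=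
  commutator_descendingCentralSeries_le hi hj (Subgroup.commutator_mem_commutator hx hy)

/-- Up to an element of weight `2i + j`, `⁅x⁻¹, y⁆` is the inverse of `⁅x, y⁆`; bracketing that
error with `z` gives weight at least `i + j + k + 1`. -/
theorem commutator_inv_left_mem {H : Subgroup G} [H.Normal] {i j k : ℕ} (hi : 1 ≤ i) (hj : 1 ≤ j)
    (hk : 1 ≤ k) (hH : descendingCentralSeries G (i + j + k + 1) ≤ H) {x y z : G}
    (hx : x ∈ descendingCentralSeries G i) (hy : y ∈ descendingCentralSeries G j)
    (hz : z ∈ descendingCentralSeries G k) (h : ⁅⁅x, y⁆, z⁆ ∈ H) : ⁅⁅x⁻¹, y⁆, z⁆ ∈ H := by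
  rw [← mem_centralizerMod] at h ⊢
  have h1 : ⁅x⁻¹, y⁆ = ⁅x⁻¹, ⁅y, x⁆⁆ * ⁅x, y⁆⁻¹ := by simp [commutatorElement_def, mul_assoc]
  rw [h1]
  refine mul_mem ?_ (inv_mem h)
  rw [mem_centralizerMod]
  refine hH ?_
  have h2 := commutatorElement_mem_descendingCentralSeries (by omega) hk
    (commutatorElement_mem_descendingCentralSeries hi (by omega) (inv_mem hx)
      (commutatorElement_mem_descendingCentralSeries hj hi hy hx)) hz
  exact descendingCentralSeries_antitone (by omega) h2

/-- The Jacobi identity modulo the lower central series. -/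
theorem commutator_commutator_mem_of_rotate {H : Subgroup G} [H.Normal] {i j k : ℕ} (hi : 1 ≤ i)
    (hj : 1 ≤ j) (hk : 1 ≤ k) (hH : descendingCentralSeries G (i + j + k + 1) ≤ H) {x y z : G}
    (hx : x ∈ descendingCentralSeries G i) (hy : y ∈ descendingCentralSeries G j)
    (hz : z ∈ descendingCentralSeries G k) (h1 : ⁅⁅y, z⁆, x⁆ ∈ H) (h2 : ⁅⁅z, x⁆, y⁆ ∈ H) :
    ⁅⁅x, y⁆, z⁆ ∈ H := by
  have h1' := commutator_inv_left_mem hj hk hi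
    ((descendingCentralSeries_antitone (by omega)).trans hH) hy hz hx h1
  have h2' := commutator_inv_left_mem hk hi hj
    ((descendingCentralSeries_antitone (by omega)).trans hH) hz hx hy h2
  -- The Hall–Witt identity. The inverses inside its brackets are removed by
  -- `commutator_inv_left_mem`, its conjugations by normality of `H`.
  have hW := conj_commutatorElement_left_commutatorElement_mul x y z
  have h3 : ⁅⁅x⁻¹, y⁆, z⁆ ∈ H := by
    have hP : (x * ⁅⁅x⁻¹, y⁆, z⁆ * x⁻¹) *
        ((z * ⁅⁅z⁻¹, x⁆, y⁆ * z⁻¹) * (y * ⁅⁅y⁻¹, z⁆, x⁆ * y⁻¹)) = 1 := by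
      rw [← hW]; simp only [mul_assoc]
    have e : ⁅⁅x⁻¹, y⁆, z⁆ = x⁻¹ * ((z * ⁅⁅z⁻¹, x⁆, y⁆ * z⁻¹) * (y * ⁅⁅y⁻¹, z⁆, x⁆ * y⁻¹))⁻¹ *
        x⁻¹⁻¹ := by
      rw [← eq_inv_of_mul_eq_one_left hP]
      simp only [mul_assoc, inv_inv, inv_mul_cancel, mul_one, inv_mul_cancel_left]
    rw [e]
    refine Subgroup.Normal.conj_mem inferInstance _ (inv_mem (mul_mem ?_ ?_)) _
    · exact Subgroup.Normal.conj_mem inferInstance _ h2' _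
    · exact Subgroup.Normal.conj_mem inferInstance _ h1' _
  have h4 := commutator_inv_left_mem hi hj hk hH (inv_mem hx) hy hz h3
  rwa [inv_inv] at h4

theorem sup_descendingCentralSeries_normal {n : ℕ} (hn : 1 ≤ n) {s : Set G}
    (hs : s ⊆ descendingCentralSeries G n) :
    (Subgroup.closure s ⊔ descendingCentralSeries G (n + 1)).Normal := by
  refine normal_of_commutatorElement_mem fun x hx g => ?_
  refine Subgroup.mem_sup_right ?_
  rw [descendingCentralSeries_succ hn]
  refine Subgroup.commutator_mem_commutator ?_ (Subgroup.mem_top g)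
  exact sup_le ((Subgroup.closure_le _).2 hs) (descendingCentralSeries_antitone (by omega)) hx

/-- Elements of the subgroup generated modulo `H` by elements central modulo `H` are products with
each generator occurring once. -/
theorem exists_list_prod_zpow_inv_mul_mem {ι : Type*} {H : Subgroup G} [H.Normal] {τ : ι → G}
    (L : List ι) (hL : L.Nodup) (hc : ∀ t ∈ L, ∀ g, ⁅τ t, g⁆ ∈ H) {s : G}
    (hs : s ∈ Subgroup.closure (τ '' {t | t ∈ L}) ⊔ H) :
    ∃ a : ι → ℤ, ((L.map fun t => τ t ^ a t).prod)⁻¹ * s ∈ H := by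
  classical
  induction L generalizing s with
  | nil => simpa using hs
  | cons t L ih =>
    have hN : (Subgroup.closure (τ '' {t | t ∈ L}) ⊔ H).Normal := by
      refine normal_of_commutatorElement_mem fun x hx g => Subgroup.mem_sup_right ?_
      rw [← mem_centralizerMod]
      refine sup_le ((Subgroup.closure_le _).2 ?_) ?_ hx
      · rintro _ ⟨u, hu, rfl⟩
        exact mem_centralizerMod.2 (hc u (List.mem_cons_of_mem _ hu) g)
      · intro y hy
        exact mem_centralizerMod.2 (Subgroup.commutator_le_left H ⊤
          (Subgroup.commutator_mem_commutator hy (Subgroup.mem_top g)))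
    have hs' : s ∈ Subgroup.zpowers (τ t) ⊔ (Subgroup.closure (τ '' {t | t ∈ L}) ⊔ H) := by
      rw [← sup_assoc, Subgroup.zpowers_eq_closure, ← Subgroup.closure_union]
      convert hs using 4
      ext y
      simp [eq_comm]
    obtain ⟨y, hy, z, hz, rfl⟩ := Subgroup.mem_sup_of_normal_right.1 hs'
    obtain ⟨k, rfl⟩ := Subgroup.mem_zpowers_iff.1 hy
    obtain ⟨a, ha⟩ := ih (List.nodup_cons.1 hL).2 (fun u hu => hc u (List.mem_cons_of_mem _ hu)) hz
    refine ⟨Function.update a t k, ?_⟩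
    have hmap : (L.map fun u => τ u ^ Function.update a t k u) = L.map fun u => τ u ^ a u := by
      refine List.map_congr_left fun u hu => ?_
      rw [Function.update_of_ne]
      rintro rfl
      exact (List.nodup_cons.1 hL).1 hu
    rw [List.map_cons, List.prod_cons, hmap, Function.update_self]
    convert ha using 1
    group

end LowerCentral

/-! ### Lyndon commutators span the lower central quotients -/

section Spanning

open scoped commutatorElement

variable {X G : Type*} [Group G]

/-- The iterated commutator prescribed by a tree. -/
def treeCommutator (f : X → G) : FreeMagma X → G
  | .of x => f x
  | .mul a b => ⁅treeCommutator f a, treeCommutator f b⁆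

theorem FreeMagma.one_le_length_word (t : FreeMagma X) : 1 ≤ t.word.length :=
  List.length_pos_iff.2 t.word_ne_nil

theorem treeCommutator_mem (f : X → G) (t : FreeMagma X) :
    treeCommutator f t ∈ descendingCentralSeries G t.word.length := by
  induction t using FreeMagma.rec with
  | of x => exact Subgroup.mem_top _
  | mul a b iha ihb =>
    rw [FreeMagma.word, List.length_append]
    exact commutatorElement_mem_descendingCentralSeries a.one_le_length_word b.one_le_length_word
      iha ihb

variable [LinearOrder X]

/-- The subgroup generated modulo `G_(N+1)` by the commutators of the Lyndon trees of size `N`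
whose right branch has a word at most `v`. -/
def lyndonSpan (f : X → G) (N : ℕ) (v : List X) : Subgroup G :=
  Subgroup.closure {g | ∃ a b, IsLyndonTree (.mul a b) ∧ (FreeMagma.mul a b).word.length = N ∧
    b.word ≤ v ∧ g = treeCommutator f (.mul a b)} ⊔ descendingCentralSeries G (N + 1)

theorem lyndonSpan_mono (f : X → G) (N : ℕ) {v w : List X} (h : v ≤ w) :
    lyndonSpan f N v ≤ lyndonSpan f N w :=
  sup_le_sup_right (Subgroup.closure_mono (by
    rintro g ⟨a, b, h1, h2, h3, h4⟩
    exact ⟨a, b, h1, h2, h3.trans h, h4⟩)) _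

theorem lyndonSpan_normal (f : X → G) {N : ℕ} (hN : 1 ≤ N) (v : List X) :
    (lyndonSpan f N v).Normal := by
  refine sup_descendingCentralSeries_normal hN ?_
  rintro _ ⟨a, b, -, rfl, -, rfl⟩
  exact treeCommutator_mem _ _

theorem descendingCentralSeries_le_lyndonSpan (f : X → G) (N : ℕ) (v : List X) :
    descendingCentralSeries G (N + 1) ≤ lyndonSpan f N v := le_sup_right

theorem commutator_mem_lyndonSpan_of_lt_lt (f : X → G) {N : ℕ} {v : List X}
    (ih : ∀ u w : FreeMagma X, IsLyndonTree u → IsLyndonTree w →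
      u.word.length + w.word.length = N → u.word < w.word → w.word < v →
      ⁅treeCommutator f u, treeCommutator f w⁆ ∈ lyndonSpan f N w.word)
    {u w : FreeMagma X} (hu : IsLyndonTree u) (hw : IsLyndonTree w)
    (hN : u.word.length + w.word.length = N) (huv : u.word < v) (hwv : w.word < v) :
    ⁅treeCommutator f u, treeCommutator f w⁆ ∈ lyndonSpan f N v := by
  rcases lt_trichotomy u.word w.word with h | h | h
  · exact lyndonSpan_mono f N hwv.le (ih u w hu hw hN h hwv)
  · rw [hu.eq_of_word_eq hw h, commutatorElement_self]
    exact one_mem _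
  · exact commutatorElement_mem_comm
      (lyndonSpan_mono f N huv.le (ih w u hw hu (by omega) h huv))

/-- Being central against `c` modulo a normal subgroup can be tested on generators: a Lyndon tree
`ab` with `b ≤ v` has word `ab < b ≤ v`, so `ih` applies to its bracket with `c`, while `G_(M+1)`
brackets into `G_(N+1)`. -/
theorem commutator_lyndonSpan_mem (f : X → G) {M N : ℕ} {v : List X} (hM : 1 ≤ M)
    (ih : ∀ u w : FreeMagma X, IsLyndonTree u → IsLyndonTree w →
      u.word.length + w.word.length = N → u.word < w.word → w.word < v →
      ⁅treeCommutator f u, treeCommutator f w⁆ ∈ lyndonSpan f N w.word)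
    {c : FreeMagma X} (hc : IsLyndonTree c) (hN : M + c.word.length = N) (hcv : c.word < v)
    {y : G} (hy : y ∈ lyndonSpan f M v) : ⁅y, treeCommutator f c⁆ ∈ lyndonSpan f N v := by
  have hnorm := lyndonSpan_normal f (show 1 ≤ N by omega) v
  rw [← mem_centralizerMod]
  refine sup_le ((Subgroup.closure_le _).2 ?_) ?_ hy
  · rintro _ ⟨a, b, hab, rfl, hb, rfl⟩
    exact mem_centralizerMod.2 (commutator_mem_lyndonSpan_of_lt_lt f ih hab hc hN
      (hab.word_mul_lt_right.trans_le hb) hcv)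
  · intro z hz
    refine mem_centralizerMod.2 (descendingCentralSeries_le_lyndonSpan f N v ?_)
    have := commutatorElement_mem_descendingCentralSeries (by omega) c.one_le_length_word hz
      (treeCommutator_mem f c)
    exact descendingCentralSeries_antitone (by omega) this

/-- This is the rewriting of a bracket of Lyndon trees into standard ones, by induction on the total
length and then on the right word. The bound by the right word is what makes the inner induction
close. -/
theorem commutator_mem_lyndonSpan [Finite X] (f : X → G) (N : ℕ) (u v : FreeMagma X)
    (hu : IsLyndonTree u) (hv : IsLyndonTree v) (hN : u.word.length + v.word.length = N)
    (huv : u.word < v.word) :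
    ⁅treeCommutator f u, treeCommutator f v⁆ ∈ lyndonSpan f N v.word := by
  induction N using Nat.strong_induction_on generalizing u v with
  | _ N ihN =>
  -- The lexicographic order need not be well founded on all words, but only finitely many have
  -- bounded length.
  have hwf : {l : List X | l.length ≤ N}.WellFoundedOn (· < ·) :=
    (List.finite_length_le X N).wellFoundedOn
  suffices H : ∀ l : List X, l.length ≤ N → ∀ u v : FreeMagma X, IsLyndonTree u → IsLyndonTree v →
      u.word.length + v.word.length = N → u.word < v.word → v.word = l →
      ⁅treeCommutator f u, treeCommutator f v⁆ ∈ lyndonSpan f N v.word from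
    H v.word (by omega) u v hu hv hN huv rfl
  clear hN huv hu hv u v
  intro l hl
  refine hwf.induction (P := fun l => ∀ u v : FreeMagma X, IsLyndonTree u → IsLyndonTree v →
      u.word.length + v.word.length = N → u.word < v.word → v.word = l →
      ⁅treeCommutator f u, treeCommutator f v⁆ ∈ lyndonSpan f N v.word) hl ?_
  rintro _ - ih u v hu hv hN huv rfl
  have ih' : ∀ u w : FreeMagma X, IsLyndonTree u → IsLyndonTree w →
      u.word.length + w.word.length = N → u.word < w.word → w.word < v.word →
      ⁅treeCommutator f u, treeCommutator f w⁆ ∈ lyndonSpan f N w.word :=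
    fun u w hu hw hN huw hwv => ih w.word (show _ ≤ N by omega) hwv
      u w hu hw hN huw rfl
  have base : IsLyndonTree (.mul u v) →
      ⁅treeCommutator f u, treeCommutator f v⁆ ∈ lyndonSpan f N v.word := fun h =>
    Subgroup.mem_sup_left (Subgroup.subset_closure
      ⟨u, v, h, by rw [FreeMagma.word, List.length_append, hN], le_rfl, rfl⟩)
  cases u with
  | of x => exact base (.of_mul x v hv huv)
  | mul a c =>
    rcases le_or_gt v.word c.word with hcv | hcv
    · exact base (.mul_mul a c v hu hv huv hcv)
    -- Now `c < v`, so the bracketing `(ac)v` is not standard. Jacobi replaces it by `(cv)a` and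
    -- `(va)c`: the inner brackets are shorter, and their expansions are then bracketed with `a` or
    -- `c`, both less than `v`.
    obtain ⟨ha, hc, hac⟩ := hu.mul_inv
    have hav := hac.trans hcv
    have l1 := a.one_le_length_word
    have l2 := c.one_le_length_word
    have l3 := v.one_le_length_word
    rw [FreeMagma.word, List.length_append] at hN
    have hnorm := lyndonSpan_normal f (show 1 ≤ N by omega) v.word
    refine commutator_commutator_mem_of_rotate l1 l2 l3 ?_ (treeCommutator_mem f a)
      (treeCommutator_mem f c) (treeCommutator_mem f v) ?_ ?_
    · rw [hN]; exact descendingCentralSeries_le_lyndonSpan f N _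
    · exact commutator_lyndonSpan_mem f (M := c.word.length + v.word.length) (by omega) ih' ha
        (by omega) hav (ihN _ (by omega) c v hc hv rfl hcv)
    · refine commutator_lyndonSpan_mem f (M := a.word.length + v.word.length) (by omega) ih' hc
        (by omega) hcv (commutatorElement_mem_comm
          (ihN _ (by omega) a v ha hv rfl hav))

/-- `G_n` is generated modulo `G_(n+1)` by the commutators of the Lyndon trees of size `n`. -/
theorem descendingCentralSeries_le_closure_lyndon [Finite X] {f : X → G}
    (hf : Subgroup.closure (Set.range f) = ⊤) {n : ℕ} (hn : 1 ≤ n) :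
    descendingCentralSeries G n ≤
      Subgroup.closure (treeCommutator f '' {t | IsLyndonTree t ∧ t.word.length = n}) ⊔
        descendingCentralSeries G (n + 1) := by
  induction n, hn using Nat.le_induction with
  | base =>
    rw [descendingCentralSeries_one, ← hf]
    refine le_sup_of_le_left (Subgroup.closure_mono ?_)
    rintro _ ⟨x, rfl⟩
    exact ⟨.of x, ⟨.of x, rfl⟩, rfl⟩
  | succ n hn ih =>
    set K := Subgroup.closure (treeCommutator f '' {t | IsLyndonTree t ∧ t.word.length = n + 1}) ⊔
        descendingCentralSeries G (n + 1 + 1) with hK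
    have hnorm : K.Normal := by
      refine sup_descendingCentralSeries_normal (by omega) ?_
      rintro _ ⟨t, ⟨-, ht⟩, rfl⟩
      rw [← ht]
      exact treeCommutator_mem f t
    have hspan : ∀ v, lyndonSpan f (n + 1) v ≤ K := fun v => by
      refine sup_le_sup_right (Subgroup.closure_mono ?_) _
      rintro _ ⟨a, b, h1, h2, -, rfl⟩
      exact ⟨_, ⟨h1, h2⟩, rfl⟩
    rw [descendingCentralSeries_succ hn, Subgroup.commutator_le]
    intro y hy g _
    rw [← mem_centralizerMod]
    refine (ih.trans (sup_le ((Subgroup.closure_le _).2 ?_) ?_)) hy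
    · rintro _ ⟨t, ⟨ht, htn⟩, rfl⟩
      refine mem_centralizerMod.2 (commutatorElement_mem_comm ?_)
      rw [← mem_centralizerMod]
      -- Commuting with `t` modulo `K` defines a subgroup, so only the free generators need to be
      -- bracketed with `t`.
      have hg : g ∈ Subgroup.closure (Set.range f) := hf ▸ Subgroup.mem_top g
      refine (Subgroup.closure_le _).2 ?_ hg
      rintro _ ⟨x, rfl⟩
      rw [SetLike.mem_coe, mem_centralizerMod]
      have hx := IsLyndonTree.of x
      have e : (FreeMagma.of x).word.length + t.word.length = n + 1 := by
        rw [htn, FreeMagma.word, List.length_singleton, add_comm]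
      rcases lt_trichotomy (FreeMagma.of x).word t.word with h | h | h
      · exact hspan _ (commutator_mem_lyndonSpan f _ (.of x) t hx ht e h)
      · rw [← hx.eq_of_word_eq ht h]
        simp [treeCommutator]
      · exact commutatorElement_mem_comm
          (hspan _ (commutator_mem_lyndonSpan f _ t (.of x) ht hx (by omega) h))
    · intro z hz
      refine mem_centralizerMod.2 (Subgroup.mem_sup_right ?_)
      rw [descendingCentralSeries_succ (by omega)]
      exact Subgroup.commutator_mem_commutator hz (Subgroup.mem_top g)

/-- Every element is, modulo `G_n`, an ordered product of powers of the commutators of the Lyndon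
trees of size less than `n`. -/
theorem exists_lyndon_prod [Finite X] {f : X → G} (hf : Subgroup.closure (Set.range f) = ⊤) {n : ℕ}
    (hn : 1 ≤ n) :
    ∃ L : List (FreeMagma X), L.Nodup ∧ (∀ t, t ∈ L ↔ IsLyndonTree t ∧ t.word.length < n) ∧
      ∀ g, ∃ a : FreeMagma X → ℤ, ((L.map fun t => treeCommutator f t ^ a t).prod)⁻¹ * g ∈
        descendingCentralSeries G n := by
  classical
  induction n, hn using Nat.le_induction with
  | base =>
    refine ⟨[], List.nodup_nil, fun t => ?_, fun g => ⟨0, Subgroup.mem_top _⟩⟩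
    have := t.one_le_length_word
    simp only [List.not_mem_nil, false_iff, not_and]
    omega
  | succ n hn ih =>
    obtain ⟨L, hL, hmem, hprod⟩ := ih
    have hfin := IsLyndonTree.finite_length_eq (X := X) n
    set T := hfin.toFinset.toList with hT
    have hTm : ∀ t, t ∈ T ↔ IsLyndonTree t ∧ t.word.length = n := fun t => by simp [hT]
    refine ⟨L ++ T, ?_, fun t => ?_, fun g => ?_⟩
    · refine List.Nodup.append hL (Finset.nodup_toList _) fun t h1 h2 => ?_
      have := ((hmem t).1 h1).2
      have := ((hTm t).1 h2).2
      omega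
    · rw [List.mem_append, hmem, hTm, ← and_or_left]
      exact and_congr_right fun _ => by omega
    · obtain ⟨a, ha⟩ := hprod g
      have h1 := descendingCentralSeries_le_closure_lyndon hf hn ha
      have hset : {t | IsLyndonTree t ∧ t.word.length = n} = {t | t ∈ T} :=
        Set.ext fun t => (hTm t).symm
      rw [hset] at h1
      obtain ⟨b, hb⟩ := exists_list_prod_zpow_inv_mul_mem T (Finset.nodup_toList _)
        (fun t ht g => by
          rw [descendingCentralSeries_succ hn, ← ((hTm t).1 ht).2]
          exact Subgroup.commutator_mem_commutator (treeCommutator_mem f t) (Subgroup.mem_top g)) h1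
      -- The trees of `L` are shorter than `n` and those of `T` have length `n`, so the two exponent
      -- functions can be glued.
      refine ⟨fun t => if t.word.length = n then b t else a t, ?_⟩
      have e1 : (L.map fun t => treeCommutator f t ^ (if t.word.length = n then b t else a t)) =
          L.map fun t => treeCommutator f t ^ a t :=
        List.map_congr_left fun t ht => by rw [if_neg ((hmem t).1 ht).2.ne]
      have e2 : (T.map fun t => treeCommutator f t ^ (if t.word.length = n then b t else a t)) =
          T.map fun t => treeCommutator f t ^ b t :=
        List.map_congr_left fun t ht => by rw [if_pos ((hTm t).1 ht).2]
      rw [List.map_append, List.prod_append, e1, e2, mul_inv_rev, mul_assoc]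
      exact hb

end Spanning

/-! ### Weight filtrations on unipotent matrices -/

section UnipotentMatrices

open scoped commutatorElement

variable {R : Type*} [CommRing R] {n : ℕ}

/-- A family of ideals `𝔞 m d` constraining, in weight `m`, the entries of a strictly upper
triangular matrix at distance `d` from the diagonal, compatibly with multiplication. -/
structure IsEntryFiltration (𝔞 : ℕ → ℕ → Ideal R) : Prop where
  mul_le : ∀ m m' d d', 1 ≤ d → 1 ≤ d' → 𝔞 m d * 𝔞 m' d' ≤ 𝔞 (m + m') (d + d')
  antitone : ∀ d, Antitone fun m => 𝔞 m d
  one : ∀ d, 1 ≤ d → 𝔞 1 d = ⊤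

/-- The strictly upper triangular matrices of weight `m` for the family `𝔞`. -/
def entryFiltration (n : ℕ) (𝔞 : ℕ → ℕ → Ideal R) (m : ℕ) :
    AddSubgroup (Matrix (Fin n) (Fin n) R) where
  carrier := {A | ∀ i j, (j ≤ i → A i j = 0) ∧ (i < j → A i j ∈ 𝔞 m (j - i))}
  zero_mem' := fun i j => ⟨fun _ => rfl, fun _ => zero_mem _⟩
  add_mem' := fun {A B} hA hB i j =>
    ⟨fun h => by rw [Matrix.add_apply, (hA i j).1 h, (hB i j).1 h, add_zero],
      fun h => add_mem ((hA i j).2 h) ((hB i j).2 h)⟩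
  neg_mem' := fun {A} hA i j =>
    ⟨fun h => by rw [Matrix.neg_apply, (hA i j).1 h, neg_zero], fun h => neg_mem ((hA i j).2 h)⟩

theorem mem_entryFiltration {𝔞 : ℕ → ℕ → Ideal R} {m : ℕ} {A : Matrix (Fin n) (Fin n) R} :
    A ∈ entryFiltration n 𝔞 m ↔
      ∀ i j, (j ≤ i → A i j = 0) ∧ (i < j → A i j ∈ 𝔞 m (j - i)) := Iff.rfl

namespace IsEntryFiltration

variable {𝔞 : ℕ → ℕ → Ideal R} (h𝔞 : IsEntryFiltration 𝔞)

include h𝔞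

theorem le {m m' : ℕ} (h : m ≤ m') : entryFiltration n 𝔞 m' ≤ entryFiltration n 𝔞 m :=
  fun _ hA i j => ⟨(hA i j).1, fun hij => h𝔞.antitone _ h ((hA i j).2 hij)⟩

theorem mul_mem {m m' : ℕ} {A B : Matrix (Fin n) (Fin n) R} (hA : A ∈ entryFiltration n 𝔞 m)
    (hB : B ∈ entryFiltration n 𝔞 m') : A * B ∈ entryFiltration n 𝔞 (m + m') := by
  refine fun i j => ⟨fun hij => ?_, fun hij => ?_⟩
  · rw [Matrix.mul_apply]
    refine Finset.sum_eq_zero fun k _ => ?_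
    rcases le_or_gt k i with hk | hk
    · rw [(hA i k).1 hk, zero_mul]
    · rw [(hB k j).1 (hij.trans hk.le), mul_zero]
  · rw [Matrix.mul_apply]
    refine sum_mem fun k _ => ?_
    rcases le_or_gt k i with hk | hk
    · rw [(hA i k).1 hk, zero_mul]; exact zero_mem _
    rcases le_or_gt j k with hk' | hk'
    · rw [(hB k j).1 hk', mul_zero]; exact zero_mem _
    have e : (j : ℕ) - i = (k - i) + (j - k) := by
      have : (i : ℕ) < k := hk
      have : (k : ℕ) < j := hk'
      omega
    rw [e]
    refine h𝔞.mul_le _ _ _ _ ?_ ?_ (Ideal.mul_mem_mul ((hA i k).2 hk) ((hB k j).2 hk'))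
    · have : (i : ℕ) < k := hk
      omega
    · have : (k : ℕ) < j := hk'
      omega

theorem pow_mem {m : ℕ} {A : Matrix (Fin n) (Fin n) R} (hA : A ∈ entryFiltration n 𝔞 m) {k : ℕ}
    (hk : 1 ≤ k) : A ^ k ∈ entryFiltration n 𝔞 (k * m) := by
  induction k, hk using Nat.le_induction with
  | base => simpa using hA
  | succ k hk ih => rw [pow_succ, Nat.succ_mul]; exact h𝔞.mul_mem ih hA

end IsEntryFiltration

namespace unipotentGroup

/-- The strictly upper triangular part `g - 1` of a unipotent matrix. -/
def sub (g : unipotentGroup n R) : Matrix (Fin n) (Fin n) R :=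
  ((g : Matrix.GeneralLinearGroup (Fin n) R) : Matrix (Fin n) (Fin n) R) - 1

theorem coe_eq (g : unipotentGroup n R) :
    ((g : Matrix.GeneralLinearGroup (Fin n) R) : Matrix (Fin n) (Fin n) R) = 1 + sub g := by
  rw [sub]; abel

theorem sub_one : sub (1 : unipotentGroup n R) = 0 := by simp [sub]

theorem sub_mul (g h : unipotentGroup n R) : sub (g * h) = sub g + sub h + sub g * sub h := by
  have : ((g * h : unipotentGroup n R) : Matrix.GeneralLinearGroup (Fin n) R).val =
    (1 + sub g) * (1 + sub h) := by rw [← coe_eq, ← coe_eq]; rfl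
  rw [sub, this]
  noncomm_ring

theorem sub_pow (g : unipotentGroup n R) (k : ℕ) : sub (g ^ k) = (sub g + 1) ^ k - 1 := by
  have : ((g ^ k : unipotentGroup n R) : Matrix.GeneralLinearGroup (Fin n) R).val =
    (sub g + 1) ^ k := by rw [add_comm, ← coe_eq]; rfl
  rw [sub, this]

theorem eq_one_of_sub_eq_zero {g : unipotentGroup n R} (h : sub g = 0) : g = 1 := by
  apply Subtype.ext
  apply Units.ext
  rw [coe_eq, h, add_zero]
  rfl

/-- This expands `⁅g, h⁆ - 1 = (gh - hg)(hg)⁻¹`: the ring commutator of `g - 1` and `h - 1` is the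
leading term. -/
theorem sub_commutator (g h : unipotentGroup n R) : sub ⁅g, h⁆ =
    (sub g * sub h - sub h * sub g) +
      (sub g * sub h - sub h * sub g) * sub (g⁻¹ * h⁻¹) := by
  have h1 : ∀ a b c : unipotentGroup n R, sub (a * c) - sub (b * c) =
      (sub a - sub b) + (sub a - sub b) * sub c := fun a b c => by
    rw [sub_mul, sub_mul]; noncomm_ring
  have h2 := h1 (g * h) (h * g) (g⁻¹ * h⁻¹)
  have e1 : g * h * (g⁻¹ * h⁻¹) = ⁅g, h⁆ := by rw [commutatorElement_def]; group
  have e2 : h * g * (g⁻¹ * h⁻¹) = 1 := by group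
  have e3 : sub (g * h) - sub (h * g) = sub g * sub h - sub h * sub g := by
    rw [sub_mul, sub_mul]; abel
  rwa [e1, e2, sub_one, sub_zero, e3] at h2

theorem sub_mem_one {𝔞 : ℕ → ℕ → Ideal R} (h𝔞 : IsEntryFiltration 𝔞) (g : unipotentGroup n R) :
    sub g ∈ entryFiltration n 𝔞 1 := by
  refine fun i j => ⟨fun hij => ?_, fun hij => ?_⟩
  · rcases hij.lt_or_eq with h | rfl
    · rw [sub, Matrix.sub_apply, g.2.1 i j h, Matrix.one_apply_ne h.ne', sub_zero]
    · rw [sub, Matrix.sub_apply, g.2.2, Matrix.one_apply_eq, sub_self]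
  · rw [h𝔞.one _ (by have : (i : ℕ) < j := hij; omega)]
    trivial

/-- The unipotent matrices `g` with `g - 1` of weight `m`. -/
def filtration {𝔞 : ℕ → ℕ → Ideal R} (h𝔞 : IsEntryFiltration 𝔞) (n m : ℕ) :
    Subgroup (unipotentGroup n R) where
  carrier := {g | sub g ∈ entryFiltration n 𝔞 m}
  one_mem' := by rw [Set.mem_ofPred, sub_one]; exact zero_mem _
  mul_mem' := fun {g h} hg hh => by
    rw [Set.mem_ofPred, sub_mul]
    exact add_mem (add_mem hg hh) (h𝔞.le (by omega) (h𝔞.mul_mem hg hh))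
  inv_mem' := fun {g} hg => by
    have h1 : sub g⁻¹ = -sub g - sub g * sub g⁻¹ := by
      have := sub_mul g g⁻¹
      rw [mul_inv_cancel, sub_one] at this
      rw [eq_sub_iff_add_eq, eq_neg_iff_add_eq_zero, this]
      abel
    rw [Set.mem_ofPred, h1]
    exact _root_.sub_mem (neg_mem hg) (h𝔞.le (by omega) (h𝔞.mul_mem hg (sub_mem_one h𝔞 g⁻¹)))

section filtration

variable {𝔞 : ℕ → ℕ → Ideal R} {h𝔞 : IsEntryFiltration 𝔞} {m m' : ℕ} {g h : unipotentGroup n R}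

theorem mem_filtration : g ∈ filtration h𝔞 n m ↔ sub g ∈ entryFiltration n 𝔞 m := Iff.rfl

theorem filtration_le (hm : m ≤ m') : filtration h𝔞 n m' ≤ filtration h𝔞 n m :=
  fun _ hg => h𝔞.le hm hg

theorem filtration_one : filtration h𝔞 n 1 = ⊤ := eq_top_iff.2 fun g _ => sub_mem_one h𝔞 g

theorem commutator_mem_filtration (hg : g ∈ filtration h𝔞 n m) (hh : h ∈ filtration h𝔞 n m') :
    ⁅g, h⁆ ∈ filtration h𝔞 n (m + m') := by
  have h1 : sub g * sub h - sub h * sub g ∈ entryFiltration n 𝔞 (m + m') :=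
    _root_.sub_mem (h𝔞.mul_mem hg hh) (by rw [add_comm]; exact h𝔞.mul_mem hh hg)
  rw [mem_filtration, sub_commutator]
  exact add_mem h1 (h𝔞.le (Nat.le_succ _) (h𝔞.mul_mem h1 (sub_mem_one h𝔞 _)))

/-- The cross term has weight `2m ≥ m + 1`, so in weight `m` the map `g ↦ g - 1` turns products into
sums modulo weight `m + 1`. -/
theorem sub_mul_sub_mem (hm : 1 ≤ m) (hg : g ∈ filtration h𝔞 n m) (hh : h ∈ filtration h𝔞 n m) :
    sub (g * h) - (sub g + sub h) ∈ entryFiltration n 𝔞 (m + 1) := by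
  rw [sub_mul, add_sub_cancel_left]
  exact h𝔞.le (by omega) (h𝔞.mul_mem hg hh)

theorem sub_inv_add_sub_mem (hm : 1 ≤ m) (hg : g ∈ filtration h𝔞 n m) :
    sub g⁻¹ + sub g ∈ entryFiltration n 𝔞 (m + 1) := by
  have := sub_mul_sub_mem hm hg (inv_mem hg)
  rw [mul_inv_cancel, sub_one, zero_sub] at this
  simpa [add_comm] using neg_mem this

theorem sub_zpow_sub_mem (hm : 1 ≤ m) (hg : g ∈ filtration h𝔞 n m) (a : ℤ) :
    sub (g ^ a) - a • sub g ∈ entryFiltration n 𝔞 (m + 1) := by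
  induction a using Int.induction_on with
  | zero => simp [sub_one, zero_mem]
  | succ k ih =>
    have h1 := add_mem (sub_mul_sub_mem hm (zpow_mem hg (k : ℤ)) hg) ih
    rw [zpow_add_one, add_smul, one_smul]
    convert h1 using 1
    abel
  | pred k ih =>
    have h1 := add_mem (add_mem (sub_mul_sub_mem hm (zpow_mem hg (-(k : ℤ))) (inv_mem hg)) ih)
      (sub_inv_add_sub_mem hm hg)
    rw [zpow_sub_one, sub_smul, one_smul]
    convert h1 using 1
    abel

theorem sub_list_prod_sub_mem {ι : Type*} (hm : 1 ≤ m) (L : List ι) (x : ι → unipotentGroup n R)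
    (hx : ∀ t ∈ L, x t ∈ filtration h𝔞 n m) :
    sub (L.map x).prod - (L.map fun t => sub (x t)).sum ∈ entryFiltration n 𝔞 (m + 1) := by
  induction L with
  | nil => simp [sub_one, zero_mem]
  | cons t L ih =>
    have hL : ∀ t ∈ L, x t ∈ filtration h𝔞 n m := fun u hu => hx u (List.mem_cons_of_mem _ hu)
    have h1 := add_mem (sub_mul_sub_mem hm (hx t List.mem_cons_self)
      (list_prod_mem (l := L.map x) (by simpa using hL))) (ih hL)
    rw [List.map_cons, List.map_cons, List.prod_cons, List.sum_cons]
    convert h1 using 1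
    abel

/-- If a product of elements of weight `m` has weight `m + 1`, and all factors but one have an entry
of weight `m + 1`, then so has the remaining factor. -/
theorem sub_apply_mem_of_list_prod_mem {ι : Type*} (hm : 1 ≤ m) {L : List ι} (hL : L.Nodup)
    (x : ι → unipotentGroup n R) (hx : ∀ t ∈ L, x t ∈ filtration h𝔞 n m)
    (hprod : (L.map x).prod ∈ filtration h𝔞 n (m + 1)) {i j : Fin n} (hij : i < j) {t₀ : ι}
    (ht₀ : t₀ ∈ L) (hother : ∀ t ∈ L, t ≠ t₀ → sub (x t) i j ∈ 𝔞 (m + 1) (j - i)) :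
    sub (x t₀) i j ∈ 𝔞 (m + 1) (j - i) := by
  have h1 := _root_.sub_mem (mem_filtration.1 hprod) (sub_list_prod_sub_mem hm L x hx)
  rw [sub_sub_cancel] at h1
  obtain ⟨L₁, L₂, rfl⟩ := List.append_of_mem ht₀
  have h2 := (h1 i j).2 hij
  have hd := List.nodup_middle.1 hL
  have hs : ∀ L : List ι, (∀ t ∈ L, sub (x t) i j ∈ 𝔞 (m + 1) (j - i)) →
      (L.map fun t => sub (x t)).sum i j ∈ 𝔞 (m + 1) (j - i) := fun L => by
    induction L with
    | nil => intro _; exact zero_mem _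
    | cons t L ih =>
      intro h
      rw [List.map_cons, List.sum_cons, Matrix.add_apply]
      exact add_mem (h t List.mem_cons_self) (ih fun u hu => h u (List.mem_cons_of_mem _ hu))
  have hne : ∀ t ∈ L₁ ++ L₂, t ≠ t₀ := fun t ht he => (List.nodup_cons.1 hd).1 (he ▸ ht)
  have h3 := hs L₁ fun t ht => hother t (by simp [ht]) (hne t (by simp [ht]))
  have h4 := hs L₂ fun t ht => hother t (by simp [ht]) (hne t (by simp [ht]))
  rw [List.map_append, List.sum_append, List.map_cons, List.sum_cons, Matrix.add_apply,
    Matrix.add_apply] at h2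
  have h5 := _root_.sub_mem (_root_.sub_mem h2 h3) h4
  convert h5 using 1
  abel

theorem descendingCentralSeries_le_comap_filtration {G : Type*} [Group G]
    (h𝔞 : IsEntryFiltration 𝔞) (ρ : G →* unipotentGroup n R) {k : ℕ} (hk : 1 ≤ k) :
    descendingCentralSeries G k ≤ (filtration h𝔞 n k).comap ρ := by
  induction k, hk using Nat.le_induction with
  | base => rw [filtration_one]; exact le_top
  | succ k hk ih =>
    rw [descendingCentralSeries_succ hk, Subgroup.commutator_le]
    intro x hx y _
    rw [Subgroup.mem_comap, map_commutatorElement]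
    exact commutator_mem_filtration (ih hx) (by rw [filtration_one]; trivial)

theorem zassenhausFiltration_le_comap_filtration {G : Type*} [Group G] {p : ℕ} [Fact p.Prime]
    (h𝔞 : IsEntryFiltration 𝔞) (ρ : G →* unipotentGroup n R)
    (hpow : ∀ k, ∀ g ∈ filtration h𝔞 n k, g ^ p ∈ filtration h𝔞 n (p * k)) (k : ℕ) :
    zassenhausFiltration p G k ≤ (filtration h𝔞 n k).comap ρ := by
  induction k using Nat.strong_induction_on with
  | _ k ih =>
  have hp : p.Prime := Fact.out
  rcases Nat.lt_or_ge k 2 with hk | hk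
  · refine le_trans ?_ (Subgroup.comap_mono (filtration_le (show k ≤ 1 by omega)))
    rw [filtration_one]; exact le_top
  have hle : k ≤ p * (k ⌈/⌉ p) := le_smul_ceilDiv hp.pos
  have hlt : k ⌈/⌉ p < k := by
    rw [Nat.ceilDiv_eq_add_pred_div, Nat.div_lt_iff_lt_mul hp.pos]
    have := Nat.mul_le_mul (show 2 ≤ k from hk) (show 1 ≤ p - 1 from by have := hp.two_le; omega)
    have h2 : k * p = k * (p - 1) + k := by
      obtain ⟨q, rfl⟩ : ∃ q, p = q + 1 := ⟨p - 1, by have := hp.two_le; omega⟩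
      simp [mul_add]
    have h3 := Nat.mul_le_mul (show 2 ≤ k from hk) (le_refl (p - 1))
    omega
  rw [zassenhausFiltration_eq p G k hk]
  refine sup_le ((Subgroup.closure_le _).2 ?_) (iSup_le fun i => iSup_le fun j => iSup_le ?_)
  · rintro _ ⟨x, hx, rfl⟩
    rw [SetLike.mem_coe, Subgroup.mem_comap, map_pow]
    exact filtration_le hle (hpow _ _ (ih _ hlt hx))
  · rintro ⟨hi, hj, hij⟩
    rw [Subgroup.commutator_le]
    intro x hx y hy
    rw [Subgroup.mem_comap, map_commutatorElement, ← hij]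
    exact commutator_mem_filtration (ih _ (by omega) hx) (ih _ (by omega) hy)

theorem descendingPCentralSeries_le_comap_filtration {G : Type*} [Group G] {p : ℕ}
    (h𝔞 : IsEntryFiltration 𝔞) (ρ : G →* unipotentGroup n R)
    (hpow : ∀ k, 1 ≤ k → ∀ g ∈ filtration h𝔞 n k, g ^ p ∈ filtration h𝔞 n (k + 1)) {k : ℕ}
    (hk : 1 ≤ k) : descendingPCentralSeries p G k ≤ (filtration h𝔞 n k).comap ρ := by
  induction k, hk using Nat.le_induction with
  | base => rw [filtration_one]; exact le_top
  | succ k hk ih =>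
    obtain ⟨k, rfl⟩ := Nat.exists_eq_add_of_le' hk
    rw [descendingPCentralSeries]
    refine sup_le ((Subgroup.closure_le _).2 ?_) ?_
    · rintro _ ⟨x, hx, rfl⟩
      rw [SetLike.mem_coe, Subgroup.mem_comap, map_pow]
      exact hpow _ hk _ (ih hx)
    · rw [Subgroup.commutator_le]
      intro x hx y _
      rw [Subgroup.mem_comap, map_commutatorElement]
      exact commutator_mem_filtration (ih hx) (by rw [filtration_one]; trivial)

end filtration

end unipotentGroup

/-- Weight `m` means vanishing at distance less than `m` from the diagonal. -/
def distanceIdeal (R : Type*) [CommRing R] (m d : ℕ) : Ideal R := if m ≤ d then ⊤ else ⊥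

theorem isEntryFiltration_distanceIdeal (R : Type*) [CommRing R] :
    IsEntryFiltration (distanceIdeal R) where
  mul_le m m' d d' _ _ := by
    unfold distanceIdeal
    by_cases h1 : m ≤ d
    · by_cases h2 : m' ≤ d'
      · rw [if_pos (show m + m' ≤ d + d' by omega)]; exact le_top
      · simp [if_neg h2]
    · simp [if_neg h1]
  antitone d m m' h := by
    simp only [distanceIdeal]
    by_cases h1 : m' ≤ d
    · rw [if_pos (h.trans h1)]; exact le_top
    · rw [if_neg h1]; exact bot_le
  one d hd := if_pos hd

/-- Weight `m` means divisibility by `p ^ (m - d)` at distance `d` from the diagonal. -/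
def primePowIdeal (R : Type*) [CommRing R] (p m d : ℕ) : Ideal R := Ideal.span {(p : R) ^ (m - d)}

theorem isEntryFiltration_primePowIdeal (R : Type*) [CommRing R] (p : ℕ) :
    IsEntryFiltration (primePowIdeal R p) where
  mul_le m m' d d' _ _ := by
    rw [primePowIdeal, primePowIdeal, primePowIdeal, Ideal.span_singleton_mul_span_singleton,
      ← pow_add, Ideal.span_singleton_le_span_singleton]
    -- Truncated subtraction is subadditive: `(m + m') - (d + d') ≤ (m - d) + (m' - d')`.
    exact pow_dvd_pow _ (by omega)
  antitone d m m' h := by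
    simp only [primePowIdeal, Ideal.span_singleton_le_span_singleton]
    exact pow_dvd_pow _ (by omega)
  one d hd := by rw [primePowIdeal, Nat.sub_eq_zero_of_le hd, pow_zero, Ideal.span_singleton_one]

namespace unipotentGroup

theorem sub_pow_prime (g : unipotentGroup n R) {p : ℕ} (hp : p.Prime) : sub (g ^ p) =
    sub g ^ p +
      p * (sub g * ∑ k ∈ Finset.Ioo 0 p, sub g ^ (k - 1) * ((p.choose k / p : ℕ) : Matrix _ _ R)) := by
  rw [sub_pow, Commute.add_pow_prime_eq hp (Commute.one_right (sub g)), one_pow]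
  simp only [one_pow, mul_one, mul_assoc]
  abel

theorem sub_pow_prime_of_charP {p : ℕ} [Fact p.Prime] [CharP R p] (g : unipotentGroup n R) :
    sub (g ^ p) = sub g ^ p := by
  rw [sub_pow_prime g Fact.out]
  have : (p : Matrix (Fin n) (Fin n) R) = 0 := by
    rw [← Matrix.diagonal_natCast, CharP.cast_eq_zero, Matrix.diagonal_zero]
  rw [this, zero_mul, add_zero]

theorem sub_pow_prime_pow_of_charP {p : ℕ} [Fact p.Prime] [CharP R p] (g : unipotentGroup n R)
    (k : ℕ) : sub (g ^ p ^ k) = sub g ^ p ^ k := by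
  induction k with
  | zero => simp
  | succ k ih => rw [pow_succ, pow_mul, sub_pow_prime_of_charP, ih, pow_mul]

theorem pow_mem_filtration_of_charP {p : ℕ} [hp : Fact p.Prime] [CharP R p]
    {𝔞 : ℕ → ℕ → Ideal R} {h𝔞 : IsEntryFiltration 𝔞} (k : ℕ) (g : unipotentGroup n R)
    (hg : g ∈ filtration h𝔞 n k) : g ^ p ∈ filtration h𝔞 n (p * k) := by
  rw [mem_filtration, sub_pow_prime_of_charP]
  exact h𝔞.pow_mem hg hp.out.one_le

/-- With `A = g - 1`, the term `A ^ p` has weight `pk ≥ k + 1`; the other binomial terms have weight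
`k` and an extra factor `p`, which is worth one more unit. -/
theorem pow_mem_filtration_primePowIdeal {p : ℕ} (hp : p.Prime) (k : ℕ) (hk : 1 ≤ k)
    (g : unipotentGroup n R) (hg : g ∈ filtration (isEntryFiltration_primePowIdeal R p) n k) :
    g ^ p ∈ filtration (isEntryFiltration_primePowIdeal R p) n (k + 1) := by
  have h𝔞 := isEntryFiltration_primePowIdeal R p
  rw [mem_filtration, sub_pow_prime g hp]
  refine add_mem (h𝔞.le ?_ (h𝔞.pow_mem hg hp.one_le)) ?_
  · have := Nat.mul_le_mul hp.two_le hk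
    have := Nat.mul_le_mul hp.two_le (le_refl k)
    omega
  have h1 : sub g * ∑ k ∈ Finset.Ioo 0 p, sub g ^ (k - 1) *
      ((p.choose k / p : ℕ) : Matrix _ _ R) ∈ entryFiltration n (primePowIdeal R p) k := by
    rw [Finset.mul_sum]
    refine sum_mem fun l hl => ?_
    have hl := (Finset.mem_Ioo.1 hl).1
    rw [← mul_assoc, ← pow_succ', Nat.sub_add_cancel hl, ← (Nat.cast_commute _ _).eq,
      ← nsmul_eq_mul]
    exact nsmul_mem (h𝔞.le (Nat.le_mul_of_pos_left k hl) (h𝔞.pow_mem hg hl)) _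
  rw [← nsmul_eq_mul]
  refine fun i j => ⟨fun h => ?_, fun h => ?_⟩
  · rw [Matrix.smul_apply, (h1 i j).1 h, smul_zero]
  · rw [Matrix.smul_apply, nsmul_eq_mul]
    have h2 := (h1 i j).2 h
    rw [primePowIdeal, Ideal.mem_span_singleton] at h2 ⊢
    refine dvd_trans ?_ (mul_dvd_mul_left _ h2)
    rw [← pow_succ']
    exact pow_dvd_pow _ (by omega)

/-- The unipotent matrix `1 + A` for a strictly upper triangular matrix `A`. -/
noncomputable def ofStrict (A : Matrix (Fin n) (Fin n) R) (hA : ∀ i j, j ≤ i → A i j = 0) :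
    unipotentGroup n R :=
  ⟨Matrix.GeneralLinearGroup.mk'' (1 + A) (by
    rw [Matrix.det_of_isUpperTriangular]
    · simp [hA _ _ le_rfl]
    · intro i j h
      have h : j < i := h
      rw [Matrix.add_apply, hA i j h.le, Matrix.one_apply_ne h.ne', add_zero]),
    fun i j h => (by
      change (1 + A) i j = 0
      rw [Matrix.add_apply, hA i j h.le, Matrix.one_apply_ne h.ne', add_zero]),
    fun i => (by
      change (1 + A) i i = 1
      rw [Matrix.add_apply, hA i i le_rfl, Matrix.one_apply_eq, add_zero])⟩

theorem sub_ofStrict (A : Matrix (Fin n) (Fin n) R) (hA : ∀ i j, j ≤ i → A i j = 0) :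
    sub (ofStrict A hA) = A := by
  change (1 + A) - 1 = A
  abel

end unipotentGroup

end UnipotentMatrices

/-! ### Representations attached to words, and leading Magnus coefficients -/

section LeadingWords

open scoped commutatorElement

variable {X : Type*} {R : Type*} [CommRing R] {n : ℕ}

/-- The factor of length `k` of the word `w` starting at position `i`. -/
def List.window (w : List X) (i k : ℕ) : List X := (w.drop i).take k

theorem List.window_add (w : List X) (i k l : ℕ) :
    w.window i (k + l) = w.window i k ++ w.window (i + k) l := by
  rw [List.window, List.window, List.window, List.take_add, List.drop_drop]

theorem List.length_window_le (w : List X) (i k : ℕ) : (w.window i k).length ≤ k := by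
  simp [List.window]

theorem List.window_zero_length (w : List X) : w.window 0 w.length = w := by simp [List.window]

variable [LinearOrder X]

/-- The matrix `A` vanishes at distance less than `|u|` from the diagonal, and its entries at
distance `|u|`, read as coefficients of the factors of `w`, vanish for factors less than `u` and are
`1` for factors equal to `u`. -/
def HasLeadingWord (w u : List X) (A : Matrix (Fin n) (Fin n) R) : Prop :=
  (∀ i j : Fin n, (j : ℕ) < i + u.length → A i j = 0) ∧
  ∀ i j : Fin n, (j : ℕ) = i + u.length →
    (A i j ≠ 0 → u ≤ w.window i u.length ∧ (w.window i u.length).length = u.length) ∧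
    (w.window i u.length = u → A i j = 1)

namespace HasLeadingWord

variable {w u v : List X} {A B E : Matrix (Fin n) (Fin n) R}

theorem mul_apply_eq (hA : HasLeadingWord w u A) (hB : HasLeadingWord w v B) {i j k : Fin n}
    (hk : (k : ℕ) = i + u.length) (hj : (j : ℕ) = i + (u ++ v).length) :
    (A * B) i j = A i k * B k j := by
  rw [List.length_append] at hj
  rw [Matrix.mul_apply, Finset.sum_eq_single k]
  · intro l _ hl
    rcases lt_or_gt_of_ne (fun h => hl (Fin.ext h) : (l : ℕ) ≠ k) with h | h
    · rw [hA.1 i l (by omega), zero_mul]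
    · rw [hB.1 l j (by omega), mul_zero]
  · simp

/-- At distance `|u| + |v|` a single intermediate index contributes, so coefficients multiply along
the splitting of the factor of `w`. -/
theorem mul (hA : HasLeadingWord w u A) (hB : HasLeadingWord w v B) :
    HasLeadingWord w (u ++ v) (A * B) := by
  refine ⟨fun i j h => ?_, fun i j h => ?_⟩
  · rw [List.length_append] at h
    rw [Matrix.mul_apply]
    refine Finset.sum_eq_zero fun l _ => ?_
    rcases lt_or_ge (l : ℕ) (i + u.length) with h' | h'
    · rw [hA.1 i l h', zero_mul]
    · rw [hB.1 l j (by omega), mul_zero]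
  · obtain ⟨k, hk⟩ : ∃ k : Fin n, (k : ℕ) = i + u.length :=
      ⟨⟨i + u.length, by rw [List.length_append] at h; omega⟩, rfl⟩
    rw [hA.mul_apply_eq hB hk h, List.length_append, List.window_add, ← hk]
    have hj : (j : ℕ) = k + v.length := by rw [h, hk, List.length_append]; omega
    refine ⟨fun hne => ?_, fun he => ?_⟩
    · obtain ⟨h1, h2⟩ := (hA.2 i k hk).1 (left_ne_zero_of_mul hne)
      obtain ⟨h3, h4⟩ := (hB.2 k j hj).1 (right_ne_zero_of_mul hne)
      -- Factors running past the end of `w` are truncated; the length clause excludes them, as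
      -- concatenation preserves inequalities only when the first words have suitable lengths.
      exact ⟨List.append_le_append_of_le h1 h2.le h3, by rw [List.length_append, h2, h4]⟩
    · have hl := congrArg List.length he
      rw [List.length_append, List.length_append] at hl
      have l1 := List.length_window_le w i u.length
      have l2 := List.length_window_le w k v.length
      obtain ⟨h1, h2⟩ := List.append_inj he (by omega)
      rw [(hA.2 i k hk).2 h1, (hB.2 k j hj).2 h2, one_mul]

theorem one (w : List X) : HasLeadingWord w [] (1 : Matrix (Fin n) (Fin n) R) := by
  refine ⟨fun i j h => Matrix.one_apply_ne ?_, fun i j h => ?_⟩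
  · rintro rfl
    simp at h
  · have : i = j := Fin.ext (by simpa using h.symm)
    subst this
    simp [List.window]

theorem pow (hA : HasLeadingWord w u A) (k : ℕ) : HasLeadingWord w (u.wordPow k) (A ^ k) := by
  induction k with
  | zero => rw [pow_zero]; exact one w
  | succ k ih => rw [pow_succ']; exact hA.mul ih

theorem sub_of_lt (hA : HasLeadingWord w u A) (hB : HasLeadingWord w v B) (h : u < v)
    (hl : u.length = v.length) : HasLeadingWord w u (A - B) := by
  refine ⟨fun i j hij => ?_, fun i j hij => ⟨fun hne => ?_, fun he => ?_⟩⟩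
  · rw [Matrix.sub_apply, hA.1 i j hij, hB.1 i j (hl ▸ hij), sub_zero]
  · rw [Matrix.sub_apply] at hne
    by_cases h0 : A i j = 0
    · rw [h0, zero_sub, neg_ne_zero] at hne
      have := (hB.2 i j (hl ▸ hij)).1 hne
      rw [← hl] at this
      exact ⟨h.le.trans this.1, this.2⟩
    · exact (hA.2 i j hij).1 h0
  · rw [Matrix.sub_apply, (hA.2 i j hij).2 he]
    by_contra hne
    have h0 : B i j ≠ 0 := fun h0 => hne (by rw [h0, sub_zero])
    have := ((hB.2 i j (hl ▸ hij)).1 h0).1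
    rw [← hl, he] at this
    exact this.not_gt h

theorem add_higher (hA : HasLeadingWord w u A)
    (hE : ∀ i j : Fin n, (j : ℕ) < i + u.length + 1 → E i j = 0) : HasLeadingWord w u (A + E) := by
  refine ⟨fun i j hij => ?_, fun i j hij => ?_⟩
  · rw [Matrix.add_apply, hA.1 i j hij, hE i j (by omega), zero_add]
  · rw [Matrix.add_apply, hE i j (by omega), add_zero]
    exact hA.2 i j hij

theorem mem_entryFiltration (hA : HasLeadingWord w u A) (hu : u ≠ []) :
    A ∈ entryFiltration n (distanceIdeal R) u.length := by
  have := List.length_pos_iff.2 hu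
  refine fun i j => ⟨fun h => hA.1 i j ?_, fun h => ?_⟩
  · have : (j : ℕ) ≤ i := h
    omega
  · have : (i : ℕ) < j := h
    rw [distanceIdeal]
    split_ifs with h'
    · trivial
    · exact hA.1 i j (by omega)

end HasLeadingWord

/-- The representation attached to a word `w`: the generator `x` goes to the unipotent matrix with
entry `1` just above the diagonal at the positions of the letter `x` in `w`. -/
noncomputable def wordRep {S : Type*} [Group S] (b : FreeGroupBasis X S) (R : Type*) [CommRing R]
    (n : ℕ) (w : List X) : S →* unipotentGroup n R :=
  b.lift fun x => unipotentGroup.ofStrict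
    (Matrix.of fun i j => if (j : ℕ) = i + 1 ∧ w.window i 1 = [x] then (1 : R) else 0)
    fun i j h => by
      have : (j : ℕ) ≤ i := h
      rw [Matrix.of_apply, if_neg (by omega)]

/-- Since `uv < vu`, the product in the order `uv` supplies the leading word of the ring commutator,
and the remaining term of `sub_commutator` lives at greater distance. -/
theorem HasLeadingWord.commutator {w u v : List X} {g h : unipotentGroup n R}
    (hu : u ≠ []) (hg : HasLeadingWord w u (unipotentGroup.sub g))
    (hh : HasLeadingWord w v (unipotentGroup.sub h)) (huv : u ++ v < v ++ u) :
    HasLeadingWord w (u ++ v) (unipotentGroup.sub ⁅g, h⁆) := by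
  have h1 := (hg.mul hh).sub_of_lt (hh.mul hg) huv (by simp [add_comm])
  rw [unipotentGroup.sub_commutator]
  refine h1.add_higher fun i j hij => ?_
  have h2 := (isEntryFiltration_distanceIdeal R).mul_mem
    (h1.mem_entryFiltration (by simp [hu]))
    (unipotentGroup.sub_mem_one (isEntryFiltration_distanceIdeal R) (g⁻¹ * h⁻¹)) i j
  rcases le_or_gt j i with hji | hji
  · exact h2.1 hji
  · have h3 := h2.2 hji
    have : (i : ℕ) < j := hji
    rwa [distanceIdeal, if_neg (by omega), Ideal.mem_bot] at h3

theorem IsLyndonTree.hasLeadingWord {S : Type*} [Group S] (b : FreeGroupBasis X S)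
    (w : List X) {t : FreeMagma X} (ht : IsLyndonTree t) :
    HasLeadingWord w t.word (unipotentGroup.sub (wordRep b R n w (treeCommutator b t))) := by
  induction t using FreeMagma.rec with
  | of x =>
    rw [treeCommutator, wordRep, FreeGroupBasis.lift_apply_apply, FreeGroupBasis.repr_apply_coe,
      FreeGroup.lift_apply_of, unipotentGroup.sub_ofStrict]
    refine ⟨fun i j h => ?_, fun i j h => ⟨fun hne => ?_, fun he => ?_⟩⟩
    · simp only [FreeMagma.word, List.length_singleton] at h
      rw [Matrix.of_apply, if_neg (by omega)]
    · rw [Matrix.of_apply] at hne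
      have := (ite_ne_right_iff.1 hne).1.2
      simp [FreeMagma.word, this]
    · rw [Matrix.of_apply, if_pos ⟨h, he⟩]
  | mul a c iha ihc =>
    obtain ⟨ha, hc, -⟩ := ht.mul_inv
    rw [treeCommutator, map_commutatorElement]
    refine (iha ha).commutator a.word_ne_nil (ihc hc) ?_
    exact ht.word_mul_lt_right.trans_le (List.self_le_append _ _)

end LeadingWords

/-! ### Extracting exponents; the integral case -/

section Conclusion

open unipotentGroup

variable {X : Type*} {S : Type*} [Group S] (b : FreeGroupBasis X S)

theorem eq_one_of_mem_filtration_self {R : Type*} [CommRing R] {n : ℕ} {g : unipotentGroup n R}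
    (hg : g ∈ filtration (isEntryFiltration_distanceIdeal R) n n) : g = 1 := by
  refine eq_one_of_sub_eq_zero (Matrix.ext fun i j => ?_)
  rcases le_or_gt j i with h | h
  · exact (hg i j).1 h
  · have := (hg i j).2 h
    rwa [distanceIdeal, if_neg (by omega), Ideal.mem_bot] at this

include b

theorem FreeGroupBasis.closure_range : Subgroup.closure (Set.range b) = ⊤ := by
  have h : Set.range b = b.repr.symm.toMonoidHom '' Set.range FreeGroup.of := by
    rw [← Set.range_comp]; rfl
  rw [h, ← MonoidHom.map_closure, FreeGroup.closure_range_of, ← MonoidHom.range_eq_map]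
  exact MonoidHom.range_eq_top.2 b.repr.symm.surjective

/-- Finite generation leaves finitely many homomorphisms to `ℤ/2`; by freeness these are all
functions `X → ℤ/2`, among which the point masses form a copy of `X`. -/
theorem FreeGroupBasis.finite_of_fg [Group.FG S] : Finite X := by
  classical
  obtain ⟨T, hT, hfin⟩ := Group.fg_iff.1 (inferInstance : Group.FG S)
  have := hfin.to_subtype
  have h1 : Finite (S →* Multiplicative (ZMod 2)) :=
    Finite.of_injective (fun φ (t : T) => φ t) fun φ ψ h =>
      MonoidHom.eq_of_eqOn_dense hT fun t ht => congrFun h ⟨t, ht⟩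
  have h2 : Finite (X → Multiplicative (ZMod 2)) := Finite.of_equiv _ b.lift.symm
  refine Finite.of_injective
    (fun x => (Pi.mulSingle x (Multiplicative.ofAdd 1) : X → Multiplicative (ZMod 2))) ?_
  intro x y h
  by_contra hne
  have h3 := congrFun h x
  simp only [Pi.mulSingle_eq_same, Pi.mulSingle_eq_of_ne hne] at h3
  exact absurd h3 (by decide)

variable [LinearOrder X]

/-- A product of powers of elements with distinct leading words is not killed by all the
representations attached to words, unless the leading words are long. -/
theorem eq_one_or_le_length_of_wordRep_prod_mem {R : Type*} [CommRing R] {ι : Type*} {n : ℕ}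
    {L : List ι} (hL : L.Nodup) (x y : ι → S) (c : ι → ℤ) (W : ι → List X)
    (hx : ∀ t ∈ L, x t = 1 ∨ x t = y t ^ c t ∧ (c t : R) ≠ 0 ∧ W t ≠ [] ∧
      ∀ w, HasLeadingWord w (W t) (sub (wordRep b R n w (y t))))
    (hW : ∀ t ∈ L, ∀ u ∈ L, x t ≠ 1 → x u ≠ 1 → W t = W u → t = u)
    (hprod : ∀ w, wordRep b R n w (L.map x).prod ∈
      filtration (isEntryFiltration_distanceIdeal R) n n) :
    ∀ t ∈ L, x t = 1 ∨ n ≤ (W t).length := by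
  classical
  by_contra! hcon
  have hne : (L.toFinset.filter fun t => x t ≠ 1).Nonempty := by
    obtain ⟨t, ht, h1, -⟩ := hcon
    exact ⟨t, by simp [ht, h1]⟩
  -- Choose a nontrivial factor with shortest, then lexicographically least, leading word; that word
  -- defines the test representation.
  obtain ⟨t₀, ht₀, hmin⟩ := Finset.exists_min_image _ (fun t => toLex ((W t).length, W t)) hne
  simp only [Finset.mem_filter, List.mem_toFinset, Prod.Lex.toLex_le_toLex] at ht₀ hmin
  obtain ⟨ht₀, hxt₀⟩ := ht₀
  obtain ⟨hy₀, hc₀, hW₀, hlead₀⟩ := (hx t₀ ht₀).resolve_left hxt₀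
  have hpos := List.length_pos_iff.2 hW₀
  have hlt : (W t₀).length < n := by
    obtain ⟨t, ht, h1, h2⟩ := hcon
    rcases hmin t ⟨ht, h1⟩ with h | h <;> omega
  set w := W t₀ with hw
  set 𝔉 := isEntryFiltration_distanceIdeal R with h𝔉
  have hmem : ∀ t ∈ L, x t ≠ 1 →
      wordRep b R n w (y t) ∈ filtration 𝔉 n (W t).length := fun t ht h1 => by
    obtain ⟨-, -, h3, h4⟩ := (hx t ht).resolve_left h1
    exact (h4 w).mem_entryFiltration h3
  have hentry : ∀ t ∈ L, x t ≠ 1 → (W t).length = w.length → ∀ i j : Fin n,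
      (j : ℕ) = i + w.length → sub (wordRep b R n w (x t)) i j =
        c t • sub (wordRep b R n w (y t)) i j := fun t ht h1 hl i j hij => by
    obtain ⟨h2, -⟩ := (hx t ht).resolve_left h1
    have h3 := (sub_zpow_sub_mem (h𝔞 := 𝔉) (m := w.length) hpos (hl ▸ hmem t ht h1) (c t) i j).2
      (by rw [Fin.lt_def]; omega)
    -- At distance `|w|`, weight `|w| + 1` means zero, so linearity modulo higher weight becomes an
    -- equality of entries.
    rw [distanceIdeal, if_neg (by omega), Ideal.mem_bot, ← map_zpow, ← h2, Matrix.sub_apply,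
      Matrix.smul_apply, sub_eq_zero] at h3
    exact h3
  let i : Fin n := ⟨0, by omega⟩
  let j : Fin n := ⟨w.length, hlt⟩
  have hij : (j : ℕ) = i + w.length := by simp [i, j]
  have hdist : (j : ℕ) - i = w.length := by simp [i, j]
  have hwin : w.window i w.length = w := w.window_zero_length
  have key := sub_apply_mem_of_list_prod_mem (h𝔞 := 𝔉) (m := w.length) hpos hL
    (fun t => wordRep b R n w (x t)) (i := i) (j := j) ?_ ?_ (by rw [Fin.lt_def]; omega) ht₀ ?_
  · rw [hdist, distanceIdeal, if_neg (by omega), Ideal.mem_bot, hentry t₀ ht₀ hxt₀ rfl i j hij,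
      ((hlead₀ w).2 i j hij).2 hwin, zsmul_one] at key
    exact hc₀ key
  · intro t ht
    by_cases h1 : x t = 1
    · rw [h1, map_one]; exact one_mem _
    · rw [((hx t ht).resolve_left h1).1, map_zpow]
      refine zpow_mem (filtration_le ?_ (hmem t ht h1)) _
      rcases hmin t ⟨ht, h1⟩ with h | h <;> omega
  · have h1 := hprod w
    rw [map_list_prod, List.map_map] at h1
    exact filtration_le hlt h1
  · intro t ht hne
    rw [hdist, distanceIdeal, if_neg (by omega), Ideal.mem_bot]
    by_cases h1 : x t = 1
    · rw [h1, map_one, sub_one]; rfl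
    obtain ⟨h2, -, h3, h4⟩ := (hx t ht).resolve_left h1
    -- A longer leading word vanishes at distance `|w|`. For equal length, a nonzero entry would
    -- force `W t ≤ w`, hence equality by minimality and `t = t₀` by distinctness.
    rcases hmin t ⟨ht, h1⟩ with h | ⟨h, h'⟩
    · have h5 : wordRep b R n w (x t) ∈ filtration 𝔉 n (W t).length := by
        rw [h2, map_zpow]; exact zpow_mem (hmem t ht h1) _
      have h6 := (h5 i j).2 (by rw [Fin.lt_def]; omega)
      rwa [hdist, distanceIdeal, if_neg (by omega), Ideal.mem_bot] at h6
    · rw [hentry t ht h1 h.symm i j hij]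
      have h5 : sub (wordRep b R n w (y t)) i j = 0 := by
        by_contra h5
        have h6 := (((h4 w).2 i j (by omega)).1 h5).1
        rw [← h, hwin] at h6
        exact hne (hW t ht t₀ ht₀ h1 hxt₀ (le_antisymm h6 h'))
      rw [h5, smul_zero]

/-- In characteristic zero a nonzero exponent stays nonzero, and all words in the product are
shorter than `n`; hence every factor is trivial and `g` is its own error term in `S_n`. -/
theorem descendingCentralSeries_eq_iInf_ker [Finite X] {n : ℕ} (hn : 1 ≤ n) :
    descendingCentralSeries S n = ⨅ ρ : S →* unipotentGroup n ℤ, ρ.ker := by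
  refine le_antisymm (le_iInf fun ρ x hx => ?_) fun g hg => ?_
  · exact eq_one_of_mem_filtration_self
      (descendingCentralSeries_le_comap_filtration (isEntryFiltration_distanceIdeal ℤ) ρ hn hx)
  obtain ⟨L, hL, hmem, hprod⟩ := exists_lyndon_prod b.closure_range hn
  obtain ⟨a, ha⟩ := hprod g
  set P := (L.map fun t => treeCommutator b t ^ a t).prod with hP
  have h1 := eq_one_or_le_length_of_wordRep_prod_mem b (R := ℤ) (n := n) hL
    (fun t => treeCommutator b t ^ a t) (treeCommutator b) a FreeMagma.word ?_ ?_ ?_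
  · have h2 : P = 1 := by
      refine List.prod_eq_one ?_
      simp only [List.mem_map, forall_exists_index, and_imp]
      rintro _ t ht rfl
      exact (h1 t ht).resolve_right (not_le.2 ((hmem t).1 ht).2)
    rwa [h2, inv_one, one_mul] at ha
  · intro t ht
    by_cases h0 : a t = 0
    · left; simp [h0]
    · exact Or.inr ⟨rfl, by simpa using h0, t.word_ne_nil,
        fun w => ((hmem t).1 ht).1.hasLeadingWord b w⟩
  · exact fun t ht u hu _ _ h => ((hmem t).1 ht).1.eq_of_word_eq ((hmem u).1 hu).1 h
  · intro w
    have h2 := descendingCentralSeries_le_comap_filtration (isEntryFiltration_distanceIdeal ℤ)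
      (wordRep b ℤ n w) hn ha
    have h3 : wordRep b ℤ n w g = 1 := (Subgroup.mem_iInf.1 hg) _
    rw [Subgroup.mem_comap, map_mul, h3, mul_one, map_inv, inv_mem_iff] at h2
    exact h2

end Conclusion

/-! ### Formal properties of the Zassenhaus and `p`-central series -/

section Filtrations

open scoped commutatorElement

variable {G : Type*} [Group G]

theorem zassenhausFiltration_zero (p : ℕ) [Fact p.Prime] : zassenhausFiltration p G 0 = ⊤ := by
  rw [zassenhausFiltration, dif_pos (by omega)]

theorem commutator_zassenhausFiltration_le (p : ℕ) [Fact p.Prime] {i j : ℕ} (hi : 1 ≤ i)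
    (hj : 1 ≤ j) : ⁅zassenhausFiltration p G i, zassenhausFiltration p G j⁆ ≤
      zassenhausFiltration p G (i + j) := by
  rw [zassenhausFiltration_eq p G (i + j) (by omega)]
  exact le_sup_of_le_right (le_iSup_of_le i (le_iSup_of_le j (le_iSup_of_le ⟨hi, hj, rfl⟩ le_rfl)))

theorem powSubgroup_mono {H K : Subgroup G} (h : H ≤ K) (m : ℕ) :
    powSubgroup H m ≤ powSubgroup K m :=
  Subgroup.closure_mono (by rintro _ ⟨x, hx, rfl⟩; exact ⟨x, h hx, rfl⟩)

theorem zassenhausFiltration_succ_le (p : ℕ) [hp : Fact p.Prime] (n : ℕ) :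
    zassenhausFiltration p G (n + 1) ≤ zassenhausFiltration p G n := by
  induction n using Nat.strong_induction_on with
  | _ n ih =>
  have anti : ∀ k ≤ n, ∀ j ≤ k, zassenhausFiltration p G k ≤ zassenhausFiltration p G j := by
    intro k hk
    induction k with
    | zero => intro j hj; rw [Nat.le_zero.1 hj]
    | succ k ihk =>
      intro j hj
      rcases hj.lt_or_eq with h | rfl
      · exact (ih k (by omega)).trans (ihk (by omega) j (by omega))
      · exact le_rfl
  rcases Nat.lt_or_ge n 2 with hn | hn
  · interval_cases n
    · rw [zassenhausFiltration_zero]; exact le_top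
    · rw [zassenhausFiltration_one]; exact le_top
  rw [zassenhausFiltration_eq p G (n + 1) (by omega)]
  refine sup_le ?_ (iSup_le fun i => iSup_le fun j => iSup_le ?_)
  · rw [zassenhausFiltration_eq p G n hn]
    refine le_sup_of_le_left (powSubgroup_mono (anti _ ?_ _ ?_) p)
    · rw [ceilDiv_le_iff_le_smul hp.out.pos, smul_eq_mul]
      have := Nat.mul_le_mul hp.out.two_le (le_refl n)
      omega
    · rw [ceilDiv_le_iff_le_smul hp.out.pos]
      exact (Nat.le_succ n).trans (le_smul_ceilDiv hp.out.pos)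
  · rintro ⟨hi, hj, hij⟩
    -- As `i + j = n + 1 ≥ 3`, one of the two indices can be lowered by one and remain positive.
    rcases Nat.lt_or_ge 1 i with h | h
    · refine (Subgroup.commutator_mono (anti i (by omega) (i - 1) (by omega)) le_rfl).trans ?_
      have := commutator_zassenhausFiltration_le (G := G) p (i := i - 1) (by omega) hj
      rwa [show i - 1 + j = n by omega] at this
    · refine (Subgroup.commutator_mono le_rfl (anti j (by omega) (j - 1) (by omega))).trans ?_
      have := commutator_zassenhausFiltration_le (G := G) p (j := j - 1) hi (by omega)
      rwa [show i + (j - 1) = n by omega] at this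

theorem zassenhausFiltration_antitone (p : ℕ) [Fact p.Prime] :
    Antitone (zassenhausFiltration p G) :=
  antitone_nat_of_succ_le (zassenhausFiltration_succ_le p)

theorem pow_mem_zassenhausFiltration (p : ℕ) [hp : Fact p.Prime] {k : ℕ} {x : G}
    (hx : x ∈ zassenhausFiltration p G k) : x ^ p ∈ zassenhausFiltration p G (p * k) := by
  rcases Nat.eq_zero_or_pos k with rfl | hk
  · rw [mul_zero, zassenhausFiltration_zero]; trivial
  have h2 := Nat.mul_le_mul hp.out.two_le hk
  rw [zassenhausFiltration_eq p G (p * k) (by omega)]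
  refine Subgroup.mem_sup_left (Subgroup.subset_closure ⟨x, ?_, rfl⟩)
  refine zassenhausFiltration_antitone p ?_ hx
  rw [ceilDiv_le_iff_le_smul hp.out.pos, smul_eq_mul]

theorem pow_prime_pow_mem_zassenhausFiltration (p : ℕ) [hp : Fact p.Prime] {k : ℕ} {x : G}
    (hx : x ∈ zassenhausFiltration p G k) (v : ℕ) :
    x ^ p ^ v ∈ zassenhausFiltration p G (p ^ v * k) := by
  induction v with
  | zero => simpa using hx
  | succ v ih =>
    rw [pow_succ, pow_mul, mul_comm (p ^ v) p, mul_assoc]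
    exact pow_mem_zassenhausFiltration p ih

theorem descendingCentralSeries_le_zassenhausFiltration (p : ℕ) [Fact p.Prime] {k : ℕ}
    (hk : 1 ≤ k) : descendingCentralSeries G k ≤ zassenhausFiltration p G k := by
  induction k, hk using Nat.le_induction with
  | base => rw [zassenhausFiltration_one]; exact le_top
  | succ k hk ih =>
    rw [descendingCentralSeries_succ hk, ← zassenhausFiltration_one p G]
    exact (Subgroup.commutator_mono ih le_rfl).trans
      (commutator_zassenhausFiltration_le p hk le_rfl)

theorem powSubgroup_normal {H : Subgroup G} (hH : H.Normal) (m : ℕ) : (powSubgroup H m).Normal where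
  conj_mem x hx g := by
    have : powSubgroup H m ≤ (powSubgroup H m).comap (MulAut.conj g).toMonoidHom := by
      refine (Subgroup.closure_le _).2 ?_
      rintro _ ⟨y, hy, rfl⟩
      refine Subgroup.subset_closure ⟨g * y * g⁻¹, hH.conj_mem y hy g, ?_⟩
      rw [conj_pow]; rfl
    exact this hx

theorem descendingPCentralSeries_succ (p : ℕ) {n : ℕ} (hn : 1 ≤ n) :
    descendingPCentralSeries p G (n + 1) = powSubgroup (descendingPCentralSeries p G n) p ⊔
      ⁅descendingPCentralSeries p G n, (⊤ : Subgroup G)⁆ := by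
  obtain ⟨n, rfl⟩ := Nat.exists_eq_add_of_le' hn
  rw [descendingPCentralSeries]

theorem descendingPCentralSeries_normal (p n : ℕ) : (descendingPCentralSeries p G n).Normal := by
  induction n with
  | zero => rw [descendingPCentralSeries]; infer_instance
  | succ n ih =>
    rcases Nat.eq_zero_or_pos n with rfl | hn
    · rw [descendingPCentralSeries]; infer_instance
    · rw [descendingPCentralSeries_succ p hn]
      have := powSubgroup_normal ih p
      infer_instance

theorem pow_mem_descendingPCentralSeries (p : ℕ) {k : ℕ} (hk : 1 ≤ k) {x : G}
    (hx : x ∈ descendingPCentralSeries p G k) : x ^ p ∈ descendingPCentralSeries p G (k + 1) := by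
  rw [descendingPCentralSeries_succ p hk]
  exact Subgroup.mem_sup_left (Subgroup.subset_closure ⟨x, hx, rfl⟩)

theorem pow_prime_pow_mem_descendingPCentralSeries (p : ℕ) {k : ℕ} (hk : 1 ≤ k) {x : G}
    (hx : x ∈ descendingPCentralSeries p G k) (v : ℕ) :
    x ^ p ^ v ∈ descendingPCentralSeries p G (k + v) := by
  induction v with
  | zero => simpa using hx
  | succ v ih =>
    rw [pow_succ, pow_mul, ← add_assoc]
    exact pow_mem_descendingPCentralSeries p (by omega) ih

theorem descendingPCentralSeries_antitone (p : ℕ) : Antitone (descendingPCentralSeries p G) := by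
  refine antitone_nat_of_succ_le fun n => ?_
  rcases Nat.eq_zero_or_pos n with rfl | hn
  · exact le_rfl
  · rw [descendingPCentralSeries_succ p hn]
    have := descendingPCentralSeries_normal (G := G) p n
    refine sup_le ((Subgroup.closure_le _).2 ?_) (Subgroup.commutator_le_left _ _)
    rintro _ ⟨x, hx, rfl⟩
    exact pow_mem hx p

theorem descendingCentralSeries_le_descendingPCentralSeries (p : ℕ) {k : ℕ} (hk : 1 ≤ k) :
    descendingCentralSeries G k ≤ descendingPCentralSeries p G k := by
  induction k, hk using Nat.le_induction with
  | base => exact le_rfl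
  | succ k hk ih =>
    rw [descendingCentralSeries_succ hk, descendingPCentralSeries_succ p hk]
    exact le_sup_of_le_right (Subgroup.commutator_mono ih le_rfl)

end Filtrations

/-! ### The Zassenhaus and `p`-central cases -/

section MainTheorem

open unipotentGroup

variable {X : Type*} {S : Type*} [Group S] [LinearOrder X]

theorem Int.exists_eq_prime_pow_mul (p : ℕ) [hp : Fact p.Prime] {a : ℤ} (ha : a ≠ 0) :
    ∃ (v : ℕ) (c : ℤ), a = (p : ℤ) ^ v * c ∧ ¬ (p : ℤ) ∣ c := by
  have hfin : FiniteMultiplicity (p : ℤ) a :=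
    Int.finiteMultiplicity_iff.2 ⟨by simpa using hp.out.ne_one, ha⟩
  obtain ⟨c, hc, hc'⟩ := hfin.exists_eq_pow_mul_and_not_dvd
  exact ⟨_, c, hc, hc'⟩

/-- Splitting off the `p`-part of each exponent leaves a unit of `𝔽_p`, and Frobenius turns `τ_t ^ p
^ v - 1` into `(τ_t - 1) ^ p ^ v`, whose leading word is a power of a Lyndon word. -/
theorem zassenhausFiltration_eq_iInf_ker [Finite X] (b : FreeGroupBasis X S) (p : ℕ)
    [hp : Fact p.Prime] {n : ℕ} (hn : 1 ≤ n) :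
    zassenhausFiltration p S n = ⨅ ρ : S →* unipotentGroup n (ZMod p), ρ.ker := by
  refine le_antisymm (le_iInf fun ρ x hx => ?_) fun g hg => ?_
  · exact eq_one_of_mem_filtration_self (zassenhausFiltration_le_comap_filtration
      (isEntryFiltration_distanceIdeal (ZMod p)) ρ pow_mem_filtration_of_charP n hx)
  obtain ⟨L, hL, hmem, hprod⟩ := exists_lyndon_prod b.closure_range hn
  obtain ⟨a, ha⟩ := hprod g
  set P := (L.map fun t => treeCommutator b t ^ a t).prod with hP
  have hvc : ∀ t, ∃ (v : ℕ) (c : ℤ), a t ≠ 0 → a t = (p : ℤ) ^ v * c ∧ ¬ (p : ℤ) ∣ c := fun t => by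
    by_cases h : a t = 0
    · exact ⟨0, 0, fun h' => absurd h h'⟩
    · obtain ⟨v, c, h⟩ := Int.exists_eq_prime_pow_mul p h
      exact ⟨v, c, fun _ => h⟩
  choose v c hvc using hvc
  have hx : ∀ t, a t ≠ 0 → treeCommutator b t ^ a t = (treeCommutator b t ^ p ^ v t) ^ c t :=
    fun t h => by
      nth_rewrite 1 [(hvc t h).1]
      rw [zpow_mul, ← Nat.cast_pow, zpow_natCast]
  have h1 := eq_one_or_le_length_of_wordRep_prod_mem b (R := ZMod p) (n := n) hL
    (fun t => treeCommutator b t ^ a t) (fun t => treeCommutator b t ^ p ^ v t) c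
    (fun t => t.word.wordPow (p ^ v t)) ?_ ?_ ?_
  · have h2 : P ∈ zassenhausFiltration p S n := by
      refine list_prod_mem ?_
      simp only [List.mem_map, forall_exists_index, and_imp]
      rintro _ t ht rfl
      by_cases h0 : a t = 0
      · rw [h0, zpow_zero]; exact one_mem _
      rcases h1 t ht with h | h
      · rw [h]; exact one_mem _
      · rw [hx t h0]
        refine zpow_mem (zassenhausFiltration_antitone p (h.trans_eq (List.length_wordPow _ _))
          (pow_prime_pow_mem_zassenhausFiltration p ?_ (v t))) _
        exact descendingCentralSeries_le_zassenhausFiltration p t.one_le_length_word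
          (treeCommutator_mem b t)
    have h3 := mul_mem h2 (descendingCentralSeries_le_zassenhausFiltration p hn ha)
    rwa [mul_inv_cancel_left] at h3
  · intro t ht
    by_cases h0 : a t = 0
    · left; simp [h0]
    refine Or.inr ⟨hx t h0, ?_, ?_, fun w => ?_⟩
    · rw [Ne, ZMod.intCast_zmod_eq_zero_iff_dvd]
      exact (hvc t h0).2
    · rw [← List.length_pos_iff, List.length_wordPow]
      exact Nat.mul_pos (pow_pos hp.out.pos _) t.one_le_length_word
    · rw [map_pow, sub_pow_prime_pow_of_charP]
      exact (((hmem t).1 ht).1.hasLeadingWord b w).pow _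
  · intro t ht u hu _ _ h
    have ht := ((hmem t).1 ht).1
    have hu := ((hmem u).1 hu).1
    exact ht.eq_of_word_eq hu (ht.isLyndonWord.eq_of_wordPow_eq hu.isLyndonWord
      (pow_ne_zero _ hp.out.ne_zero) (pow_ne_zero _ hp.out.ne_zero) h)
  · intro w
    have h2 := descendingCentralSeries_le_comap_filtration
      (isEntryFiltration_distanceIdeal (ZMod p)) (wordRep b (ZMod p) n w) hn ha
    have h3 : wordRep b (ZMod p) n w g = 1 := (Subgroup.mem_iInf.1 hg) _
    rw [Subgroup.mem_comap, map_mul, h3, mul_one, map_inv, inv_mem_iff] at h2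
    exact h2

theorem eq_one_of_mem_filtration_primePowIdeal {p k m n : ℕ} (hmn : n - k ≥ m)
    {g : unipotentGroup (k + 1) (ZMod (p ^ m))}
    (hg : g ∈ filtration (isEntryFiltration_primePowIdeal (ZMod (p ^ m)) p) (k + 1) n) : g = 1 := by
  refine eq_one_of_sub_eq_zero (Matrix.ext fun i j => ?_)
  rcases le_or_gt j i with h | h
  · exact (hg i j).1 h
  · have h1 := (hg i j).2 h
    rw [primePowIdeal, Ideal.mem_span_singleton] at h1
    have h2 : (p : ZMod (p ^ m)) ^ (n - ((j : ℕ) - i)) = 0 := by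
      rw [← Nat.cast_pow, ZMod.natCast_eq_zero_iff]
      exact pow_dvd_pow p (by omega)
    rw [h2, zero_dvd_iff] at h1
    exact h1

/-- Because `e - k ≤ m`, the power `p ^ (e - k)` divides the modulus, so divisibility lifts from
`ℤ/p^m` to `ℤ`. -/
theorem prime_pow_dvd_of_mem_primePowIdeal {p k m e : ℕ} (hm : e - k ≤ m) {a : ℤ}
    (h : (a : ZMod (p ^ m)) ∈ primePowIdeal (ZMod (p ^ m)) p e k) : (p : ℤ) ^ (e - k) ∣ a := by
  rw [primePowIdeal, Ideal.mem_span_singleton] at h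
  obtain ⟨x, hx⟩ := h
  obtain ⟨x, rfl⟩ := ZMod.intCast_surjective x
  have h1 : ((a - (p : ℤ) ^ (e - k) * x : ℤ) : ZMod (p ^ m)) = 0 := by
    push_cast
    rw [hx, sub_self]
  rw [ZMod.intCast_zmod_eq_zero_iff_dvd] at h1
  have h2 : (p : ℤ) ^ (e - k) ∣ a - (p : ℤ) ^ (e - k) * x :=
    (pow_dvd_pow _ hm).trans (by exact_mod_cast h1)
  exact (dvd_sub_left (dvd_mul_right _ _)).1 h2

/-- A product of powers of the commutators of distinct Lyndon trees is killed by all the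
representations attached to words only if the exponents are divisible enough by `p`. -/
theorem le_length_add_of_wordRep_prod_mem (b : FreeGroupBasis X S) {p : ℕ} [hp : Fact p.Prime]
    {n : ℕ} {L : List (FreeMagma X)} (hL : L.Nodup) (hLyndon : ∀ t ∈ L, IsLyndonTree t)
    (a c : FreeMagma X → ℤ) (v : FreeMagma X → ℕ)
    (hvc : ∀ t, a t ≠ 0 → a t = (p : ℤ) ^ v t * c t ∧ ¬ (p : ℤ) ∣ c t)
    (hprod : ∀ k, 1 ≤ k → k ≤ n - 1 → ∀ w,
      wordRep b (ZMod (p ^ (n - k))) (k + 1) w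
        (L.map fun t => treeCommutator b t ^ a t).prod ∈
      filtration (isEntryFiltration_primePowIdeal (ZMod (p ^ (n - k))) p) (k + 1) n) :
    ∀ t ∈ L, a t = 0 ∨ n ≤ t.word.length + v t := by
  classical
  by_contra! hcon
  have hne : (L.toFinset.filter fun t => a t ≠ 0).Nonempty := by
    obtain ⟨t, ht, h1, -⟩ := hcon
    exact ⟨t, by simp [ht, h1]⟩
  -- Least weight `|t| + v t` comes first, so the whole product is linear modulo weight `m + 1`;
  -- length and word break ties.
  obtain ⟨t₀, ht₀, hmin⟩ := Finset.exists_min_image _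
    (fun t => toLex (t.word.length + v t, toLex (t.word.length, t.word))) hne
  simp only [Finset.mem_filter, List.mem_toFinset, Prod.Lex.toLex_le_toLex] at ht₀ hmin
  obtain ⟨ht₀, hat₀⟩ := ht₀
  set k := t₀.word.length with hk
  set m := k + v t₀ with hm
  set w := t₀.word with hw
  have hk1 : 1 ≤ k := t₀.one_le_length_word
  have hlt : m < n := by
    obtain ⟨t, ht, h1, h2⟩ := hcon
    rcases hmin t ⟨ht, h1⟩ with h | ⟨h, -⟩ <;> omega
  -- Size `k + 1` puts the coefficient of `w` in the corner. Since `v t₀ + 1 ≤ n - k`, this modulus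
  -- still detects whether `p ^ (v t₀ + 1)` divides `a t₀`.
  set R := ZMod (p ^ (n - k)) with hR
  set 𝔉 := isEntryFiltration_primePowIdeal R p
  set 𝔇 := isEntryFiltration_distanceIdeal R
  set ρ := wordRep b R (k + 1) w with hρ
  have hlead : ∀ t ∈ L, HasLeadingWord w t.word (sub (ρ (treeCommutator b t))) :=
    fun t ht => (hLyndon t ht).hasLeadingWord b w
  have hD : ∀ t, ρ (treeCommutator b t) ∈ filtration 𝔇 (k + 1) t.word.length := fun t =>
    descendingCentralSeries_le_comap_filtration 𝔇 ρ t.one_le_length_word (treeCommutator_mem b t)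
  have hF : ∀ t, a t ≠ 0 →
      ρ (treeCommutator b t ^ a t) ∈ filtration 𝔉 (k + 1) (t.word.length + v t) := fun t h => by
    refine descendingPCentralSeries_le_comap_filtration (p := p) 𝔉 ρ
      (pow_mem_filtration_primePowIdeal hp.out) (by have := t.one_le_length_word; omega) ?_
    nth_rewrite 1 [(hvc t h).1]
    rw [zpow_mul, ← Nat.cast_pow, zpow_natCast]
    exact zpow_mem (pow_prime_pow_mem_descendingPCentralSeries p t.one_le_length_word
      (descendingCentralSeries_le_descendingPCentralSeries p t.one_le_length_word
        (treeCommutator_mem b t)) _) _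
  let i : Fin (k + 1) := ⟨0, by omega⟩
  let j : Fin (k + 1) := ⟨k, by omega⟩
  have hij : (j : ℕ) = i + k := by simp [i, j]
  have hijlt : i < j := by rw [Fin.lt_def]; omega
  have hdist : (j : ℕ) - i = k := by simp [i, j]
  have hwin : w.window i k = w := w.window_zero_length
  have hentry : ∀ t, t.word.length = k → sub (ρ (treeCommutator b t ^ a t)) i j =
      a t • sub (ρ (treeCommutator b t)) i j := fun t hl => by
    have h3 := (sub_zpow_sub_mem (h𝔞 := 𝔇) hk1 (hl ▸ hD t) (a t) i j).2 hijlt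
    rw [hdist, distanceIdeal, if_neg (by omega), Ideal.mem_bot, ← map_zpow, Matrix.sub_apply,
      Matrix.smul_apply, sub_eq_zero] at h3
    exact h3
  have key := sub_apply_mem_of_list_prod_mem (h𝔞 := 𝔉) (m := m) (by omega) hL
    (fun t => ρ (treeCommutator b t ^ a t)) (i := i) (j := j) ?_ ?_ hijlt ht₀ ?_
  · rw [hdist, hentry t₀ rfl, ((hlead t₀ ht₀).2 i j hij).2 hwin, zsmul_one] at key
    have h1 := prime_pow_dvd_of_mem_primePowIdeal (by omega) key
    rw [(hvc t₀ hat₀).1, show m + 1 - k = v t₀ + 1 by omega, pow_succ] at h1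
    exact (hvc t₀ hat₀).2 ((mul_dvd_mul_iff_left
      (pow_ne_zero _ (by exact_mod_cast hp.out.ne_zero))).1 h1)
  · intro t ht
    by_cases h1 : a t = 0
    · rw [h1, zpow_zero, map_one]; exact one_mem _
    · refine filtration_le ?_ (hF t h1)
      rcases hmin t ⟨ht, h1⟩ with h | ⟨h, -⟩ <;> omega
  · have h1 := hprod k hk1 (by omega) w
    rw [map_list_prod, List.map_map] at h1
    exact filtration_le hlt h1
  · intro t ht hne
    by_cases h1 : a t = 0
    · rw [h1, zpow_zero, map_one, sub_one]; exact zero_mem _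
    -- Larger weight gives the extra divisibility directly; a longer tree vanishes at distance `k`;
    -- a tree of the same length with a larger word has zero coefficient at `w`.
    rcases hmin t ⟨ht, h1⟩ with h | ⟨-, h | ⟨h, h'⟩⟩
    · exact (filtration_le (show m + 1 ≤ _ from h) (hF t h1) i j).2 hijlt
    · have h5 : ρ (treeCommutator b t ^ a t) ∈ filtration 𝔇 (k + 1) t.word.length := by
        rw [map_zpow]; exact zpow_mem (hD t) _
      have h6 := (h5 i j).2 hijlt
      rw [hdist, distanceIdeal, if_neg (by omega), Ideal.mem_bot] at h6
      rw [h6]; exact zero_mem _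
    · have h5 : sub (ρ (treeCommutator b t)) i j = 0 := by
        by_contra h5
        have h6 := (((hlead t ht).2 i j (by omega)).1 h5).1
        rw [← h, hwin] at h6
        exact hne ((hLyndon t ht).eq_of_word_eq (hLyndon t₀ ht₀) (le_antisymm h6 h'))
      rw [hentry t h.symm, h5, smul_zero]; exact zero_mem _

theorem descendingPCentralSeries_eq_iInf_ker [Finite X] (b : FreeGroupBasis X S) (p : ℕ)
    [hp : Fact p.Prime] {n : ℕ} (hn : 1 ≤ n) :
    descendingPCentralSeries p S n = ⨅ (k : ℕ) (_ : 1 ≤ k ∧ k ≤ n - 1),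
      ⨅ ρ : S →* unipotentGroup (k + 1) (ZMod (p ^ (n - k))), ρ.ker := by
  refine le_antisymm (le_iInf fun k => le_iInf fun hk => le_iInf fun ρ x hx => ?_) fun g hg => ?_
  · exact eq_one_of_mem_filtration_primePowIdeal le_rfl
      (descendingPCentralSeries_le_comap_filtration (isEntryFiltration_primePowIdeal _ p) ρ
        (pow_mem_filtration_primePowIdeal hp.out) hn hx)
  obtain ⟨L, hL, hmem, hprod⟩ := exists_lyndon_prod b.closure_range hn
  obtain ⟨a, ha⟩ := hprod g
  set P := (L.map fun t => treeCommutator b t ^ a t).prod with hP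
  have hvc : ∀ t, ∃ (v : ℕ) (c : ℤ), a t ≠ 0 → a t = (p : ℤ) ^ v * c ∧ ¬ (p : ℤ) ∣ c := fun t => by
    by_cases h : a t = 0
    · exact ⟨0, 0, fun h' => absurd h h'⟩
    · obtain ⟨v, c, h⟩ := Int.exists_eq_prime_pow_mul p h
      exact ⟨v, c, fun _ => h⟩
  choose v c hvc using hvc
  have h1 := le_length_add_of_wordRep_prod_mem b (p := p) (n := n) hL
    (fun t ht => ((hmem t).1 ht).1) a c v hvc ?_
  · have h2 : P ∈ descendingPCentralSeries p S n := by
      refine list_prod_mem ?_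
      simp only [List.mem_map, forall_exists_index, and_imp]
      rintro _ t ht rfl
      by_cases h0 : a t = 0
      · rw [h0, zpow_zero]; exact one_mem _
      nth_rewrite 1 [(hvc t h0).1]
      rw [zpow_mul, ← Nat.cast_pow, zpow_natCast]
      refine zpow_mem (descendingPCentralSeries_antitone p ((h1 t ht).resolve_left h0)
        (pow_prime_pow_mem_descendingPCentralSeries p t.one_le_length_word ?_ (v t))) _
      exact descendingCentralSeries_le_descendingPCentralSeries p t.one_le_length_word
        (treeCommutator_mem b t)
    have h3 := mul_mem h2 (descendingCentralSeries_le_descendingPCentralSeries p hn ha)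
    rwa [mul_inv_cancel_left] at h3
  · intro k hk1 hk2 w
    have h2 := descendingPCentralSeries_le_comap_filtration
      (isEntryFiltration_primePowIdeal (ZMod (p ^ (n - k))) p)
      (wordRep b (ZMod (p ^ (n - k))) (k + 1) w) (pow_mem_filtration_primePowIdeal hp.out) hn
      (descendingCentralSeries_le_descendingPCentralSeries p hn ha)
    have h3 : wordRep b (ZMod (p ^ (n - k))) (k + 1) w g = 1 :=
      (Subgroup.mem_iInf.1 (Subgroup.mem_iInf.1 (Subgroup.mem_iInf.1 hg k) ⟨hk1, hk2⟩)) _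
    rw [Subgroup.mem_comap, map_mul, h3, mul_one, map_inv, inv_mem_iff] at h2
    exact h2

end MainTheorem

theorem mainTheorem6 {S : Type*} [Group S] [IsFreeGroup S] [Group.FG S]
    (p : ℕ) [Fact p.Prime] (n : ℕ) (hn : 1 ≤ n) :
    zassenhausFiltration p S n = (⨅ ρ : S →* unipotentGroup n (ZMod p), ρ.ker) ∧
    descendingCentralSeries S n = (⨅ ρ : S →* unipotentGroup n ℤ, ρ.ker) ∧
    descendingPCentralSeries p S n =
      ⨅ (k : ℕ) (_ : 1 ≤ k ∧ k ≤ n - 1),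
        ⨅ ρ : S →* unipotentGroup (k + 1) (ZMod (p ^ (n - k))), ρ.ker := by
  have b := IsFreeGroup.basis S
  have hfin := b.finite_of_fg
  classical
  -- Any linear order on the free generators serves to define Lyndon words.
  let : LinearOrder (IsFreeGroup.Generators S) := linearOrderOfSTO WellOrderingRel
  exact ⟨zassenhausFiltration_eq_iInf_ker b p hn, descendingCentralSeries_eq_iInf_ker b hn,
    descendingPCentralSeries_eq_iInf_ker b p hn⟩
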